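/- Let $R$ be a complete admissible ring, i.e. a one-dimensional, Noetherian, local, Cohen--Macaulay, analytically reduced and residually rational ring (every residue field of the integral closure of $R$ in its total ring of fractions $K$ equals the residue field of $R$), complete in the topology of its maximal ideal, whose residue field has at least $r$ elements, where $\wp_1,\dots,\wp_r$ ($r\ge 1$) are the minimal primes of $R$. Put $I=\{1,\dots,r\}$ and $I'=\{1,\dots,r-1\}$. For $J\subseteq I$ let $R_J=R/\bigcap_{j\in J}\wp_j$, let $K_J$ be its total ring of fractions, and let $\pi_J\colon K\to K_J$ be the natural projection (for $J=\emptyset$ these are zero rings). For $i\in I$ the integral closure of $R/\wp_i$ in its field of fractions $K_i$ is a discrete valuation ring; let $v_i$ be its normalized valuation, with $v_i(0)=\infty$, and for $h\in K_J$ and $j\in J$ write $v_j(h)$ for the value of the image of $h$ in $K_j$. Let $\mathcal I$ be a regular fractional ideal of $R$, i.e. an $R$-submodule of $K$ containing a regular element of $R$ with $d\,\mathcal I\subseteq R$ for some regular $d\in R$. Let $E\subseteq\mathbb Z^r$ be its value set, the set of all $(v_1(h),\dots,v_r(h))$ with $h\in\mathcal I$ not a zero divisor of $K$, and for $\emptyset\ne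 J\subseteq I$ let $E_J\subseteq\mathbb Z^J$ be the set of all $(v_j(h))_{j\in J}$ with $h\in\pi_J(\mathcal I)$ not a zero divisor of $K_J$; write $E_r=E_{\{r\}}\subseteq\mathbb Z$. For $\gamma\in\mathbb Z^r$ and $\delta\in\mathbb Z^{I'}$ put $$\mathcal I(\gamma)=\{h\in\mathcal I:\ v_i(h)\ge\gamma_i\ \ \forall i\in I\},\qquad \pi_{I'}(\mathcal I)(\delta)=\{h\in\pi_{I'}(\mathcal I):\ v_i(h)\ge\delta_i\ \ \forall i\in I'\}.$$ Let $\mathcal L(E_r)=\{x\in\mathbb Z:\ x>\min E_r,\ x\notin E_r\}$. For $A\subseteq\mathbb Z^J$, $\alpha\in\mathbb Z^J$ and $\emptyset\neq T\subseteq J$ let $F_T(A,\alpha)$ be the set of $\beta\in A$ with $\beta_t=\alpha_t$ for $t\in T$ and $\beta_t>\alpha_t$ for $t\in J\setminus T$. A relative maximal of $A$ is a point $\alpha\in A$ with $F_{\{i\}}(A,\alpha)=\emptyset$ for all $i\in J$ and $F_T(A,\alpha)\ne\emptyset$ for all $T\subseteq J$ with $\#T\ge2$; $RM(A)$ denotes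 the set of these points. Then, in the product order of $\mathbb Z^r$, $E$ has a least element $\alpha^0$, and there is a least element $c(E)$ among the $\delta\in E$ with $\delta+\mathbb N^r\subseteq E$. For every $\gamma\in\mathbb Z^r$ with $\gamma\ge c(E)$, all the quantities below are finite, and, with $\ell$ the length of $R$-modules, $$\ell\left(\frac{\mathcal I}{\mathcal I(\gamma)}\right)=\ell\left(\frac{\pi_{I'}(\mathcal I)}{\pi_{I'}(\mathcal I)(\gamma_1,\dots,\gamma_{r-1})}\right)+(\gamma_r-\alpha^0_r)-\#\mathcal L(E_r)-\#\left(\bigcup_{\{r\}\subsetneq J\subseteq I}\{\beta_r:\ \beta\in RM(E_J)\}\right).$$ -/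

import Mathlib

open scoped nonZeroDivisors WithZero

namespace Colength

universe u

/-- Complete admissible rings: one-dimensional, Noetherian, local, Cohen-Macaulay, analytically
reduced, residually rational rings with sufficiently large residue field which are complete for
the topology of the maximal ideal. -/
structure IsCompleteAdmissible (R : Type u) [CommRing R] [IsLocalRing R] : Prop where
  noetherian : IsNoetherianRing R
  dim_one : ringKrullDim R = 1
  complete : IsAdicComplete (IsLocalRing.maximalIdeal R) R
  /-- For a one-dimensional Noetherian local ring, depth equals dimension exactly when the
  maximal ideal contains a regular element. -/
  cohenMacaulay : ∃ x ∈ IsLocalRing.maximalIdeal R, x ∈ R⁰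
  analyticallyReduced : IsReduced (AdicCompletion (IsLocalRing.maximalIdeal R) R)
  /-- The residue fields of the integral closure of `R` in its total ring of fractions are all
  equal to the residue field of `R`. -/
  residuallyRational : ∀ n : Ideal (integralClosure R (FractionRing R)), n.IsMaximal →
    Function.Surjective (algebraMap R (integralClosure R (FractionRing R) ⧸ n))
  largeResidueField : (minimalPrimes R).encard ≤ ENat.card (IsLocalRing.ResidueField R)

section Valuation

/-- For a domain `A` whose integral closure in its field of fractions is a discrete valuation
ring, the normalized valuation of that ring, written multiplicatively: `exp (-n)` is the value of
an element of order `n`, and `0` is the value of `0`. (When the integral closure is not a discrete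
valuation ring, the value is a dummy.) -/
noncomputable def normVal (A : Type u) [CommRing A] [IsDomain A] :
    Valuation (FractionRing A) ℤᵐ⁰ :=
  open Classical in
  if _h : IsDiscreteValuationRing (integralClosure A (FractionRing A)) then
    haveI : IsFractionRing (integralClosure A (FractionRing A)) (FractionRing A) :=
      integralClosure.isFractionRing_of_finite_extension (FractionRing A) (FractionRing A)
    (IsDiscreteValuationRing.maximalIdeal
      (integralClosure A (FractionRing A))).valuation (FractionRing A)
  else 1

theorem normVal_algebraMap_le_one (A : Type u) [CommRing A] [IsDomain A] (a : A) :
    normVal A (algebraMap A (FractionRing A) a) ≤ 1 := by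
  classical
  unfold normVal
  split_ifs with h
  · have : IsFractionRing (integralClosure A (FractionRing A)) (FractionRing A) :=
      integralClosure.isFractionRing_of_finite_extension (FractionRing A) (FractionRing A)
    rw [IsScalarTower.algebraMap_apply A (integralClosure A (FractionRing A)) (FractionRing A)]
    exact IsDedekindDomain.HeightOneSpectrum.valuation_le_one _ _
  · exact Valuation.one_apply_le_one (Γ₀ := ℤᵐ⁰) _

end Valuation

section Branches

variable {R : Type u} [CommRing R] {r : ℕ} (P : Fin r ≃ minimalPrimes R)

instance (i : Fin r) : (P i).1.IsPrime := (P i).2.1.1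

/-- `R_i = R / ℘_i`. -/
abbrev BranchRing (i : Fin r) : Type u := R ⧸ (P i).1

/-- `K_i`, the field of fractions of `R_i`. -/
abbrev BranchField (i : Fin r) : Type u := FractionRing (BranchRing P i)

/-- `⋂_{j ∈ J} ℘_j`. -/
abbrev interIdeal (J : Finset (Fin r)) : Ideal R := ⨅ j ∈ J, (P j).1

/-- `R_J = R / ⋂_{j ∈ J} ℘_j`. -/
abbrev PartialRing (J : Finset (Fin r)) : Type u := R ⧸ interIdeal P J

/-- `K_J`, the total ring of fractions of `R_J`. -/
abbrev PartialFrac (J : Finset (Fin r)) : Type u := FractionRing (PartialRing P J)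

theorem interIdeal_le {J : Finset (Fin r)} {j : Fin r} (hj : j ∈ J) :
    interIdeal P J ≤ (P j).1 := iInf₂_le j hj

theorem regular_notMem (i : Fin r) {x : R} (hx : x ∈ R⁰) : x ∉ (P i).1 := fun h =>
  Set.disjoint_left.mp (Ideal.disjoint_nonZeroDivisors_of_mem_minimalPrimes (P i).2) h hx

theorem regular_le_comap_branch (i : Fin r) :
    R⁰ ≤ (BranchRing P i)⁰.comap (Ideal.Quotient.mk (P i).1) := by
  intro x hx
  rw [Submonoid.mem_comap, mem_nonZeroDivisors_iff_ne_zero, Ne, Ideal.Quotient.eq_zero_iff_mem]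
  exact regular_notMem P i hx

theorem regular_le_comap_partial (J : Finset (Fin r)) :
    R⁰ ≤ (PartialRing P J)⁰.comap (Ideal.Quotient.mk (interIdeal P J)) := by
  intro x hx
  rw [Submonoid.mem_comap, mem_nonZeroDivisors_iff_right]
  intro y
  obtain ⟨y, rfl⟩ := Ideal.Quotient.mk_surjective y
  rw [← map_mul, Ideal.Quotient.eq_zero_iff_mem, Ideal.Quotient.eq_zero_iff_mem]
  simp only [Submodule.mem_iInf]
  intro h j hj
  exact ((P j).2.1.1.mem_or_mem (h j hj)).resolve_right (regular_notMem P j hx)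

theorem partial_regular_le_comap_branch (J : Finset (Fin r)) (j : J) :
    (PartialRing P J)⁰ ≤
      (BranchRing P j)⁰.comap (Ideal.Quotient.factor (interIdeal_le P j.2)) := by
  intro x hx
  obtain ⟨x, rfl⟩ := Ideal.Quotient.mk_surjective x
  rw [Submonoid.mem_comap, mem_nonZeroDivisors_iff_ne_zero, Ideal.Quotient.factor_mk, Ne,
    Ideal.Quotient.eq_zero_iff_mem]
  intro hxj
  have hmin : (P j).1 ∈ (interIdeal P J).minimalPrimes :=
    ⟨⟨(P j).2.1.1, interIdeal_le P j.2⟩, fun q hq hle => (P j).2.2 ⟨hq.1, bot_le⟩ hle⟩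
  obtain ⟨y, hy, hxy⟩ := Ideal.exists_mul_mem_of_mem_minimalPrimes hmin hxj
  apply hy
  rw [← Ideal.Quotient.eq_zero_iff_mem] at hxy ⊢
  rw [map_mul] at hxy
  exact (mem_nonZeroDivisors_iff.mp hx).1 _ hxy

/-- The projection `π_i : K → K_i` extending `R → R_i`. -/
noncomputable def projBranch (i : Fin r) : FractionRing R →+* BranchField P i :=
  IsLocalization.map (BranchField P i) (Ideal.Quotient.mk (P i).1) (regular_le_comap_branch P i)

/-- The projection `π_J : K → K_J` extending `R → R_J`. -/
noncomputable def projPartialHom (J : Finset (Fin r)) : FractionRing R →+* PartialFrac P J :=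
  IsLocalization.map (PartialFrac P J) (Ideal.Quotient.mk (interIdeal P J))
    (regular_le_comap_partial P J)

/-- The projection `K_J → K_j` extending `R_J → R_j`, for `j ∈ J`. -/
noncomputable def projPartialBranch (J : Finset (Fin r)) (j : J) :
    PartialFrac P J →+* BranchField P j :=
  IsLocalization.map (BranchField P j) (Ideal.Quotient.factor (interIdeal_le P j.2))
    (partial_regular_le_comap_branch P J j)

/-- `π_J : K → K_J` as an `R`-linear map. -/
noncomputable def projPartial (J : Finset (Fin r)) : FractionRing R →ₗ[R] PartialFrac P J :=
  AlgHom.toLinearMap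
    { projPartialHom P J with
      commutes' := fun a => by
        change projPartialHom P J (algebraMap R (FractionRing R) a) = _
        rw [projPartialHom, IsLocalization.map_eq]
        rfl }

/-- `h ↦ v_i (π_i h)` on `K`. -/
noncomputable def val (i : Fin r) : Valuation (FractionRing R) ℤᵐ⁰ :=
  (normVal (BranchRing P i)).comap (projBranch P i)

/-- `h ↦ v_j (π_j h)` on `K_J`, for `j ∈ J`. -/
noncomputable def partialVal (J : Finset (Fin r)) (j : J) : Valuation (PartialFrac P J) ℤᵐ⁰ :=
  (normVal (BranchRing P j)).comap (projPartialBranch P J j)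

theorem val_algebraMap_le_one (i : Fin r) (a : R) :
    val P i (algebraMap R (FractionRing R) a) ≤ 1 := by
  rw [val, Valuation.comap_apply, projBranch, IsLocalization.map_eq]
  exact normVal_algebraMap_le_one _ _

theorem partialVal_algebraMap_le_one (J : Finset (Fin r)) (j : J) (a : R) :
    partialVal P J j (algebraMap R (PartialFrac P J) a) ≤ 1 := by
  rw [IsScalarTower.algebraMap_apply R (PartialRing P J) (PartialFrac P J),
    partialVal, Valuation.comap_apply, projPartialBranch, IsLocalization.map_eq]
  exact normVal_algebraMap_le_one _ _

end Branches

section ValueSets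

variable {R : Type u} [CommRing R] {L : Type u} [CommRing L] [Algebra R L] {ι : Type}

/-- The value set of an `R`-submodule `M` of `L` with respect to a family `w` of valuations:
the vectors of orders of the elements of `M` that are not zero divisors of `L`. The order of an
element `h` for the (multiplicatively written) valuation `w i` is `-log (w i h)`. -/
def valueSet (w : ι → Valuation L ℤᵐ⁰) (M : Submodule R L) : Set (ι → ℤ) :=
  {α | ∃ h ∈ M, h ∈ L⁰ ∧ ∀ i, α i = -WithZero.log (w i h)}

/-- `M(γ)`: the elements of `M` whose order is at least `γ i` for every `i`, where an element with
zero image in the `i`-th branch has order `∞` there. -/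
def truncation (w : ι → Valuation L ℤᵐ⁰) (hw : ∀ i (a : R), w i (algebraMap R L a) ≤ 1)
    (M : Submodule R L) (γ : ι → ℤ) : Submodule R L where
  carrier := {h | h ∈ M ∧ ∀ i, w i h ≤ WithZero.exp (-γ i)}
  zero_mem' := ⟨M.zero_mem, fun i => by simp⟩
  add_mem' := fun ha hb =>
    ⟨M.add_mem ha.1 hb.1, fun i => (w i).map_add_le (ha.2 i) (hb.2 i)⟩
  smul_mem' := fun a h hh => ⟨M.smul_mem a hh.1, fun i => by
    rw [Algebra.smul_def, map_mul]
    exact (mul_le_of_le_one_left' (hw i a)).trans (hh.2 i)⟩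

end ValueSets

section Ideals

variable {R : Type u} [CommRing R] {r : ℕ} (P : Fin r ≃ minimalPrimes R)
  (M : FractionalIdeal R⁰ (FractionRing R))

/-- The value set `E` of a fractional ideal. -/
def idealValueSet : Set (Fin r → ℤ) :=
  valueSet (val P) (M : Submodule R (FractionRing R))

/-- `π_J` of a fractional ideal. -/
noncomputable def projIdeal (J : Finset (Fin r)) : Submodule R (PartialFrac P J) :=
  (M : Submodule R (FractionRing R)).map (projPartial P J)

/-- `E_J`, the value set of `π_J` of a fractional ideal. -/
def projValueSet (J : Finset (Fin r)) : Set (J → ℤ) :=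
  valueSet (partialVal P J) (projIdeal P M J)

/-- `ℓ_R (𝓘 / 𝓘(γ))`. -/
noncomputable def colength (γ : Fin r → ℤ) : ℕ∞ :=
  Module.length R ((M : Submodule R (FractionRing R)) ⧸
    (truncation (val P) (val_algebraMap_le_one P) (M : Submodule R (FractionRing R)) γ).submoduleOf
      (M : Submodule R (FractionRing R)))

/-- `ℓ_R (π_J(𝓘) / π_J(𝓘)(δ))`. -/
noncomputable def projColength (J : Finset (Fin r)) (δ : J → ℤ) : ℕ∞ :=
  Module.length R (projIdeal P M J ⧸
    (truncation (partialVal P J) (partialVal_algebraMap_le_one P J)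
      (projIdeal P M J) δ).submoduleOf (projIdeal P M J))

/-- `E_i` for a single index `i`, as a set of integers. -/
def branchValueSet (i : Fin r) : Set ℤ :=
  (fun β : ({i} : Finset (Fin r)) → ℤ => β ⟨i, Finset.mem_singleton_self i⟩) ''
    projValueSet P M {i}

end Ideals

section Combinatorics

variable {ι : Type}

/-- `c` is the conductor of `E`: the least element `c` of `E` with `c + ℕ^ι ⊆ E`. -/
def IsConductor (E : Set (ι → ℤ)) (c : ι → ℤ) : Prop :=
  IsLeast {δ | δ ∈ E ∧ ∀ β, δ ≤ β → β ∈ E} c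

/-- The fiber `F_J(A, α)`. -/
def fiber (J : Finset ι) (A : Set (ι → ℤ)) (α : ι → ℤ) : Set (ι → ℤ) :=
  {β | β ∈ A ∧ (∀ j ∈ J, β j = α j) ∧ ∀ j ∉ J, α j < β j}

/-- Maximal points. -/
def IsMaximalPoint (A : Set (ι → ℤ)) (α : ι → ℤ) : Prop :=
  α ∈ A ∧ ∀ i, fiber {i} A α = ∅

/-- The set `RM(A)` of relative maximals. -/
def relMaximals (A : Set (ι → ℤ)) : Set (ι → ℤ) :=
  {α | IsMaximalPoint A α ∧ ∀ J : Finset ι, 2 ≤ J.card → (fiber J A α).Nonempty}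

/-- The gaps of a set of integers above its minimum. -/
def gaps (S : Set ℤ) : Set ℤ :=
  {x | (∃ y ∈ S, y < x) ∧ x ∉ S}

/-- The union over all `J` with `{i} ⊊ J` of the sets of `i`-th coordinates of the relative
maximals of `A J`. -/
def relMaximalCoords {r : ℕ} (A : ∀ J : Finset (Fin r), Set (J → ℤ)) (i : Fin r) : Set ℤ :=
  {x | ∃ (J : Finset (Fin r)) (hJ : {i} ⊂ J), ∃ β ∈ relMaximals (A J),
    x = β ⟨i, hJ.1 (Finset.mem_singleton_self i)⟩}

end Combinatorics

end Colength

/-! Write `M` for the fractional ideal and let `N ⊆ M` consist of the elements of order at least `γ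
j` on every branch `j ≠ r`. Projecting away branch `r` identifies `M / N` with the quotient of
`π_{I'}(M)`, so the correction term is the length of `N / M(γ)`. Filter `N` by the order on branch
`r`: residual rationality makes every step of length 0 or 1, so this length counts the orders below
`γ r` taken on `N` (`length_quotient_ball`). Since `γ ≥ c(E)`, the component of an element of `N`
off branch `r` already lies in `M`, so these are the `pureOrders`, taken by elements of `M` that
vanish on all other branches.

The integers from `α⁰ r` up to `γ r` split into gaps of `E_r`, pure orders, and non-pure elements of
`E_r`. The heart of the proof, `setOf_relMaximals_eq`, says that the last kind are exactly the
`r`-th coordinates of the relative maximals of the `E_J`. A pure order would give a point in the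
fiber forbidden by maximality. Conversely, for a non-pure order, a minimal obstruction to raising
the orders on the other branches is a relative maximal (`exists_relMaximal`).

The ring theory is condensed into `IsBranchSystem` and a conductor. Completeness makes each branch
normalization a discrete valuation ring, finite over its branch. The size of the residue field gives
`exists_map_eq_max`, hence closure of value sets under infima. -/

namespace Colength

/-! ### Integral domains over a complete local ring are local. -/

section Completeness

open IsLocalRing

theorem isPrecomplete_of_finite {A : Type*} [CommRing A] (I : Ideal A) [IsPrecomplete I A]
    (N : Type*) [AddCommGroup N] [Module A N] [Module.Finite A N] : IsPrecomplete I N := by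
  rw [← AdicCompletion.of_surjective_iff]
  intro y
  obtain ⟨t, rfl⟩ := AdicCompletion.ofTensorProduct_surjective_of_finite I N y
  induction t with
  | zero => exact ⟨0, by simp⟩
  | tmul a m =>
    obtain ⟨a, rfl⟩ := AdicCompletion.of_surjective I A a
    refine ⟨a • m, ?_⟩
    rw [AdicCompletion.ofTensorProduct_tmul, map_smul]
    rfl
  | add s t hs ht =>
    obtain ⟨x, hx⟩ := hs
    obtain ⟨y, hy⟩ := ht
    exact ⟨x + y, by rw [map_add, map_add, hx, hy]⟩

theorem map_maximalIdeal_le_jacobson {A B : Type*} [CommRing A] [IsLocalRing A] [CommRing B]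
    [Algebra A B] [Algebra.IsIntegral A B] :
    (maximalIdeal A).map (algebraMap A B) ≤ (⊥ : Ideal B).jacobson := by
  refine le_sInf fun Q hQ => ?_
  have := hQ.2
  rw [Ideal.map_le_iff_le_comap,
    eq_maximalIdeal (Ideal.isMaximal_comap_of_isIntegral_of_isMaximal (R := A) Q)]

/-- A finite domain over a complete Noetherian local ring is local. -/
theorem isUnit_or_isUnit_one_sub_of_finite {A B : Type*} [CommRing A] [IsLocalRing A]
    [IsNoetherianRing A] [IsAdicComplete (maximalIdeal A) A] [CommRing B] [IsDomain B]
    [Algebra A B] [Module.Finite A B] (x : B) : IsUnit x ∨ IsUnit (1 - x) := by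
  set I := (maximalIdeal A).map (algebraMap A B) with hI
  have hjac : I ≤ (⊥ : Ideal B).jacobson := map_maximalIdeal_le_jacobson
  have : IsNoetherianRing B := IsNoetherianRing.of_finite A B
  have h1 : IsHausdorff I B := IsHausdorff.of_le_jacobson I B hjac
  have h2 : IsPrecomplete I B :=
    IsPrecomplete.map_algebraMap_iff.mpr (isPrecomplete_of_finite (maximalIdeal A) B)
  have h3 : IsAdicComplete I B := { h1, h2 with }
  have hunit : ∀ b : B, IsUnit (Ideal.Quotient.mk I b) → IsUnit b := fun b hb =>
    (isLocalHom_of_le_jacobson_bot I hjac).map_nonunit b hb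
  have : IsArtinianRing (B ⧸ I) := by
    have : Module.Finite (A ⧸ maximalIdeal A) (B ⧸ I) :=
      Module.Finite.of_restrictScalars_finite A _ _
    let := Ideal.Quotient.field (maximalIdeal A)
    exact IsArtinianRing.of_finite (A ⧸ maximalIdeal A) (B ⧸ I)
  -- In the Artinian ring `B ⧸ I` the powers of `z` stabilize, and `z ^ n = z ^ (n + 1) * y` makes
  -- `(z * y) ^ n` idempotent.
  obtain ⟨n, y, hy⟩ := IsArtinian.exists_pow_succ_smul_dvd (Ideal.Quotient.mk I x) (1 : B ⧸ I)
  set z := Ideal.Quotient.mk I x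
  have hy1 : z ^ n = z ^ n * (z * y) := by
    simp only [smul_eq_mul, mul_one, Nat.succ_eq_add_one] at hy
    rw [← mul_assoc, ← pow_succ, hy]
  have hy2 : ∀ m, z ^ n = z ^ n * (z * y) ^ m := by
    intro m
    induction m with
    | zero => simp
    | succ m ih => rw [pow_succ, ← mul_assoc, ← ih, ← hy1]
  have hidem : (z * y) ^ n * (z * y) ^ n = (z * y) ^ n := by
    conv_rhs => rw [mul_pow, hy2 n]
    rw [mul_pow]; ring
  obtain ⟨e, he⟩ := Ideal.Quotient.mk_surjective ((z * y) ^ n)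
  -- Hensel lifts the idempotent: the derivative `2e - 1` of `X ^ 2 - X` squares to 1 modulo `I`. In
  -- the domain `B` the lift is 0 or 1, so `z` is nilpotent or a unit.
  obtain ⟨a, ha, hae⟩ := HenselianRing.is_henselian (I := I)
    (Polynomial.X ^ 2 - Polynomial.X : Polynomial B)
    (by
      apply Polynomial.Monic.sub_of_left (Polynomial.monic_X_pow 2)
      rw [Polynomial.degree_X_pow, Polynomial.degree_X]; norm_num) e
    (by
      rw [← Ideal.Quotient.eq_zero_iff_mem]
      simp [he, sq, hidem])
    (by
      have : Ideal.Quotient.mk I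
        (Polynomial.eval e (Polynomial.X ^ 2 - Polynomial.X : Polynomial B).derivative)
          = 2 * (z * y) ^ n - 1 := by
        simp [he, one_add_one_eq_two, map_ofNat]
      rw [this]
      refine IsUnit.of_mul_eq_one (2 * (z * y) ^ n - 1) ?_
      linear_combination 4 * hidem)
  have ha' : a * (a - 1) = 0 := by
    simp only [Polynomial.IsRoot.def, Polynomial.eval_sub, Polynomial.eval_pow,
      Polynomial.eval_X] at ha
    linear_combination ha
  have hae' : Ideal.Quotient.mk I a = (z * y) ^ n := by
    rw [← he]; exact Ideal.Quotient.eq.mpr hae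
  rcases mul_eq_zero.mp ha' with h | h
  · right
    apply hunit
    rw [h, map_zero] at hae'
    have hz : z ^ n = 0 := by rw [hy2 n, ← hae', mul_zero]
    rw [map_sub, map_one]
    exact IsNilpotent.isUnit_one_sub ⟨n, hz⟩
  · rw [sub_eq_zero] at h
    rw [h, map_one] at hae'
    rcases Nat.eq_zero_or_pos n with rfl | hn
    · left
      apply hunit
      refine IsUnit.of_mul_eq_one y ?_
      simpa using hy1.symm
    · left
      apply hunit
      refine isUnit_of_mul_isUnit_left (y := y) ?_
      exact (isUnit_pow_iff hn.ne').mp (hae' ▸ isUnit_one)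

/-- The dichotomy for `x` is decided in the finite subalgebra generated by `x`. Hence the
normalization is known to be local without any finiteness. -/
theorem isLocalRing_of_isIntegral {A B : Type*} [CommRing A] [IsLocalRing A]
    [IsNoetherianRing A] [IsAdicComplete (maximalIdeal A) A] [CommRing B] [IsDomain B]
    [Algebra A B] [Algebra.IsIntegral A B] : IsLocalRing B := by
  refine IsLocalRing.of_isUnit_or_isUnit_one_sub_self fun x => ?_
  have : Module.Finite A (Algebra.adjoin A {x}) :=
    Module.Finite.iff_fg.mpr (Algebra.IsIntegral.isIntegral (R := A) x).fg_adjoin_singleton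
  have h := isUnit_or_isUnit_one_sub_of_finite (A := A)
    (⟨x, Algebra.self_mem_adjoin_singleton A x⟩ : Algebra.adjoin A {x})
  exact h.imp (fun h => h.map (Algebra.adjoin A {x}).val)
    (fun h => by simpa using h.map (Algebra.adjoin A {x}).val)

end Completeness

/-! ### Lengths and the Krull-Akizuki argument. -/

section KrullAkizuki

open Pointwise

/-- Additivity on `0 → N / f⁻¹(p) → M / p → M / f(N) → 0`. Injectivity of `f` is not needed, as its
kernel lies in `f⁻¹(p)`. -/
theorem length_quotient_eq_add {A M N : Type*} [Ring A] [AddCommGroup M] [Module A M]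
    [AddCommGroup N] [Module A N] (f : N →ₗ[A] M) {p : Submodule A M}
    (hp : p ≤ LinearMap.range f) :
    Module.length A (M ⧸ p) =
      Module.length A (N ⧸ p.comap f) + Module.length A (M ⧸ LinearMap.range f) := by
  refine Module.length_eq_add_of_exact (Submodule.mapQ (p.comap f) p f le_rfl)
    (Submodule.factor hp) ?_ (Submodule.factor_surjective _) ?_
  · rw [← LinearMap.ker_eq_bot, LinearMap.ker_eq_bot']
    intro n hn
    obtain ⟨n, rfl⟩ := Submodule.Quotient.mk_surjective _ n
    rw [Submodule.mapQ_apply, Submodule.Quotient.mk_eq_zero] at hn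
    rwa [Submodule.Quotient.mk_eq_zero]
  · intro b
    obtain ⟨b, rfl⟩ := Submodule.mkQ_surjective _ b
    rw [Submodule.factor_mk, Submodule.mkQ_apply, Submodule.Quotient.mk_eq_zero]
    constructor
    · rintro ⟨n, rfl⟩
      exact ⟨Submodule.Quotient.mk n, by simp⟩
    · rintro ⟨n, hn⟩
      obtain ⟨n, rfl⟩ := Submodule.Quotient.mk_surjective _ n
      rw [Submodule.mapQ_apply, Submodule.mkQ_apply, Submodule.Quotient.eq] at hn
      have := Submodule.sub_mem _ (LinearMap.mem_range_self f n) (hp hn)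
      rwa [sub_sub_cancel] at this

/-- For `N` isomorphic to a nonzero ideal `𝔞`, compute the length of `A / x𝔞` through `𝔞` and
through `xA`. As `xA / x𝔞 ≅ A / 𝔞` has finite length, it cancels. -/
theorem length_quotient_smul_top_le {A : Type*} [CommRing A] [IsDomain A] [IsNoetherianRing A]
    [Ring.KrullDimLE 1 A] {N : Type*} [AddCommGroup N] [Module A N] (g : N →ₗ[A] A)
    (hg : Function.Injective g) {x : A} (hx : x ≠ 0) :
    Module.length A (N ⧸ (x • ⊤ : Submodule A N)) ≤
      Module.length A (A ⧸ (x • ⊤ : Submodule A A)) := by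
  by_cases hN : LinearMap.range g = ⊥
  · have : Subsingleton N := ⟨fun a b => hg (by
      rw [LinearMap.range_eq_bot.mp hN]; rfl)⟩
    rw [Module.length_eq_zero]
    exact zero_le
  obtain ⟨a, ha, ha0⟩ := Submodule.exists_mem_ne_zero_of_ne_bot hN
  have hfin : Module.length A (A ⧸ LinearMap.range g) ≠ ⊤ := by
    rw [Module.length_ne_top_iff]
    have h := isFiniteLength_quotient_span_singleton A (mem_nonZeroDivisors_of_ne_zero ha0)
    refine h.of_surjective (f := Submodule.factor (p := Ideal.span {a}) ?_)
      (Submodule.factor_surjective _)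
    rwa [Ideal.span_singleton_le_iff_mem]
  have hle : (x • LinearMap.range g : Submodule A A) ≤ LinearMap.range g := by
    rintro _ ⟨_, ⟨n, rfl⟩, rfl⟩
    exact ⟨x • n, by simp⟩
  have e1 := length_quotient_eq_add g hle
  have hc1 : (x • LinearMap.range g : Submodule A A).comap g = x • ⊤ := by
    ext n
    constructor
    · rintro ⟨_, ⟨n', rfl⟩, h⟩
      exact ⟨n', trivial, hg (by simpa using h)⟩
    · rintro ⟨n', -, rfl⟩
      exact ⟨g n', ⟨n', rfl⟩, by simp⟩
  have hr : LinearMap.range (LinearMap.lsmul A A x) = x • ⊤ := by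
    ext a
    constructor
    · rintro ⟨n, rfl⟩
      exact ⟨n, trivial, rfl⟩
    · rintro ⟨n, -, rfl⟩
      exact ⟨n, rfl⟩
  have e2 := length_quotient_eq_add (LinearMap.lsmul A A x)
    (p := x • LinearMap.range g) (hr ▸ Submodule.map_mono le_top)
  have hc2 : (x • LinearMap.range g : Submodule A A).comap (LinearMap.lsmul A A x) =
      LinearMap.range g := by
    ext n
    constructor
    · rintro ⟨n', hn', h⟩
      have : n' = n := mul_left_cancel₀ hx (by simpa using h)
      exact this ▸ hn'
    · intro hn
      exact ⟨n, hn, by simp⟩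
  rw [hc1] at e1
  rw [hr, hc2] at e2
  rw [e1, add_comm] at e2
  exact (ENat.add_right_injective_of_ne_top hfin e2).le

/-- A finitely generated submodule of maximal length is everything, since adjoining one more element
would increase the length. -/
theorem finite_of_length_fg_le {A Q : Type*} [Ring A] [AddCommGroup Q] [Module A Q] (ℓ : ℕ)
    (h : ∀ F : Submodule A Q, F.FG → Module.length A F ≤ ℓ) : Module.Finite A Q := by
  set S : Set ℕ := {m | ∃ F : Submodule A Q, F.FG ∧ Module.length A F = m} with hS
  have hne : S.Nonempty := ⟨0, ⊥, Submodule.fg_bot, by simp⟩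
  have hbdd : BddAbove S := ⟨ℓ, by
    rintro m ⟨F, hF, hm⟩
    have := h F hF
    rw [hm] at this
    exact_mod_cast this⟩
  obtain ⟨F, hF, hm⟩ := Nat.sSup_mem hne hbdd
  suffices F = ⊤ from ⟨this ▸ hF⟩
  rw [eq_top_iff]
  intro q _
  by_contra hq
  have hlt : F < F ⊔ Submodule.span A {q} := by
    refine lt_of_le_of_ne le_sup_left fun he => hq ?_
    rw [he]
    exact Submodule.mem_sup_right (Submodule.mem_span_singleton_self q)
  have hfg : (F ⊔ Submodule.span A {q}).FG := hF.sup (Submodule.fg_span_singleton q)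
  have hle := h _ hfg
  obtain ⟨m, hm'⟩ := ENat.ne_top_iff_exists.mp (ne_top_of_le_ne_top (ENat.natCast_ne_top ℓ) hle)
  have h1 : m ≤ sSup S := le_csSup hbdd ⟨_, hfg, hm'.symm⟩
  have h2 : Module.length A F < Module.length A (F ⊔ Submodule.span A {q} : Submodule A Q) := by
    rw [Module.length_submodule, Module.length_submodule]
    refine Order.height_strictMono hlt ?_
    rw [← Module.length_submodule, hm]
    exact ENat.natCast_lt_top _
  rw [hm, ← hm'] at h2
  exact absurd h1 (not_le.mpr (by exact_mod_cast h2))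

theorem exists_smul_mem_range_of_finite {A : Type*} [CommRing A]
    {K : Type*} [CommRing K] [Algebra A K] [IsFractionRing A K] {N : Type*} [AddCommGroup N]
    [Module A N] [Module.Finite A N] (j : N →ₗ[A] K) :
    ∃ b ∈ A⁰, ∀ v, b • j v ∈ LinearMap.range (Algebra.linearMap A K) := by
  obtain ⟨s, hs⟩ := Module.Finite.fg_top (R := A) (M := N)
  obtain ⟨b, hb⟩ := IsLocalization.exist_integer_multiples A⁰ s j
  refine ⟨b, b.2, fun v => ?_⟩
  have hv : v ∈ Submodule.span A (s : Set N) := hs ▸ Submodule.mem_top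
  induction hv using Submodule.span_induction with
  | mem v hv => exact hb v hv
  | zero => simp
  | add v w _ _ hv hw => rw [map_add, smul_add]; exact Submodule.add_mem _ hv hw
  | smul c v _ hv => rw [map_smul, smul_comm]; exact Submodule.smul_mem _ c hv

theorem exists_injective_linearMap_of_finite {A : Type*} [CommRing A] [IsDomain A]
    {K : Type*} [Field K] [Algebra A K] [IsFractionRing A K] {N : Type*} [AddCommGroup N]
    [Module A N] [Module.Finite A N] (j : N →ₗ[A] K) (hj : Function.Injective j) :
    ∃ g : N →ₗ[A] A, Function.Injective g := by
  obtain ⟨b, hb, hint⟩ := exists_smul_mem_range_of_finite j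
  have hinj := IsFractionRing.injective A K
  have hb0 : algebraMap A K b ≠ 0 := by
    rw [Ne, map_eq_zero_iff _ hinj]; exact nonZeroDivisors.ne_zero hb
  let e := LinearEquiv.ofInjective (Algebra.linearMap A K) hinj
  refine ⟨e.symm.toLinearMap ∘ₗ (b • j).codRestrict _ hint,
    e.symm.injective.comp fun v w h => hj ?_⟩
  have hvw : b • j v = b • j w := congrArg Subtype.val h
  rw [Algebra.smul_def, Algebra.smul_def] at hvw
  exact mul_left_cancel₀ hb0 hvw

/-- Krull-Akizuki: rank one modules over a one-dimensional Noetherian domain have finite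
quotients. -/
theorem finite_quotient_smul_top {A : Type*} [CommRing A] [IsDomain A] [IsNoetherianRing A]
    [Ring.KrullDimLE 1 A] {K : Type*} [Field K] [Algebra A K] [IsFractionRing A K]
    {V : Type*} [AddCommGroup V] [Module A V] (j : V →ₗ[A] K) (hj : Function.Injective j)
    {x : A} (hx : x ≠ 0) :
    Module.Finite A (V ⧸ (x • ⊤ : Submodule A V)) := by
  have hfin : Module.length A (A ⧸ (x • ⊤ : Submodule A A)) ≠ ⊤ := by
    have h := isFiniteLength_quotient_span_singleton A (mem_nonZeroDivisors_of_ne_zero hx)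
    rw [Module.length_ne_top_iff]
    refine h.of_surjective (f := Submodule.factor (p := Ideal.span {x}) ?_)
      (Submodule.factor_surjective _)
    rw [Ideal.span_singleton_le_iff_mem]
    exact ⟨1, trivial, by simp⟩
  obtain ⟨ℓ, hℓ⟩ := ENat.ne_top_iff_exists.mp hfin
  -- A finitely generated `F ⊆ V / xV` lifts to a finitely generated `N ⊆ V`. Clearing denominators
  -- embeds `N` in `A`, and `N / xN` surjects onto `F`, so the length of `A / xA` bounds all `F`
  -- uniformly.
  refine finite_of_length_fg_le ℓ fun F hF => ?_
  obtain ⟨N, hN, rfl⟩ : ∃ N : Submodule A V, N.FG ∧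
      N.map (Submodule.mkQ (x • ⊤ : Submodule A V)) = F := by
    classical
    obtain ⟨s, rfl⟩ := hF
    choose f hf using Submodule.mkQ_surjective (x • ⊤ : Submodule A V)
    refine ⟨Submodule.span A (s.image f : Finset V), ⟨_, rfl⟩, ?_⟩
    rw [Submodule.map_span]
    congr 1
    ext q
    simp only [Finset.coe_image, Set.mem_image, Finset.mem_coe, exists_exists_and_eq_and]
    constructor
    · rintro ⟨a, ha, rfl⟩
      rwa [hf]
    · intro hq
      exact ⟨q, hq, hf q⟩
  have : Module.Finite A N := Module.Finite.iff_fg.mpr hN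
  obtain ⟨g, hg⟩ := exists_injective_linearMap_of_finite (j ∘ₗ N.subtype)
    (hj.comp N.subtype_injective)
  rw [hℓ]
  refine le_trans ?_ (length_quotient_smul_top_le g hg hx)
  refine Module.length_le_of_surjective (Submodule.liftQ (x • ⊤ : Submodule A N)
    ((Submodule.mkQ (x • ⊤ : Submodule A V)).submoduleMap N) ?_) ?_
  · rintro _ ⟨n, -, rfl⟩
    rw [LinearMap.mem_ker]
    apply Subtype.ext
    refine (Submodule.Quotient.mk_eq_zero _).mpr ?_
    exact ⟨n, trivial, rfl⟩
  · intro q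
    obtain ⟨n, rfl⟩ := LinearMap.submoduleMap_surjective _ N q
    exact ⟨Submodule.Quotient.mk n, by simp⟩

end KrullAkizuki

end Colength

namespace Colength

/-! ### The normalization of a branch is a discrete valuation ring. -/

section Normalization

open IsLocalRing Pointwise

variable (A : Type*) [CommRing A] [IsDomain A] [IsNoetherianRing A] [Ring.KrullDimLE 1 A]

/-- A nonzero ideal contains some nonzero `a` from `A`. By Krull-Akizuki `V / aV` is finite over
`A`, so the ideal is finitely generated modulo `aV`. -/
theorem isNoetherianRing_integralClosure (K : Type*) [Field K] [Algebra A K]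
    [IsFractionRing A K] : IsNoetherianRing (integralClosure A K) := by
  set V := integralClosure A K
  rw [isNoetherianRing_iff_ideal_fg]
  intro b
  by_cases hb : b = ⊥
  · rw [hb]; exact Submodule.fg_bot
  obtain ⟨y, hy, hy0⟩ := Submodule.exists_mem_ne_zero_of_ne_bot hb
  obtain ⟨a, ha, ha0⟩ := Submodule.exists_mem_ne_zero_of_ne_bot
    (Ideal.comap_ne_bot_of_integral_mem (R := A) hy0 hy (Algebra.IsIntegral.isIntegral y))
  have hfin := finite_quotient_smul_top (V := V) V.val.toLinearMap Subtype.val_injective ha0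
  have hN : IsNoetherian A (V ⧸ Ideal.span {algebraMap A V a}) := by
    refine isNoetherian_of_surjective (M := V ⧸ (a • ⊤ : Submodule A V))
      (Submodule.liftQ (a • ⊤ : Submodule A V)
        ((Ideal.Quotient.mkₐ A (Ideal.span {algebraMap A V a})).toLinearMap) ?_) ?_
    · rintro _ ⟨v, -, rfl⟩
      refine Ideal.Quotient.eq_zero_iff_mem.mpr ?_
      rw [DistribSMul.toLinearMap_apply, Algebra.smul_def]
      exact Ideal.mul_mem_right _ _ (Ideal.mem_span_singleton_self _)
    · rw [LinearMap.range_eq_top]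
      intro q
      obtain ⟨v, rfl⟩ := Ideal.Quotient.mk_surjective q
      exact ⟨Submodule.Quotient.mk v, rfl⟩
  have hN' : IsNoetherian V (V ⧸ Ideal.span {algebraMap A V a}) := isNoetherian_of_tower A hN
  refine Submodule.fg_of_fg_map_of_fg_inf_ker (Submodule.mkQ (Ideal.span {algebraMap A V a}))
    (hN'.noetherian _) ?_
  rw [Submodule.ker_mkQ, inf_eq_right.mpr]
  · exact ⟨{algebraMap A V a}, by simp⟩
  · rwa [Ideal.span_singleton_le_iff_mem]

variable [IsLocalRing A] [IsAdicComplete (maximalIdeal A) A]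

/-- Nakayama for complete rings: lifts of generators of `V / xV` span a precomplete submodule that
surjects onto `V` modulo the maximal ideal. It is all of `V` because `V`, a Noetherian domain, is
separated. -/
theorem finite_integralClosure (hA : ¬ IsField A) (K : Type*) [Field K] [Algebra A K]
    [IsFractionRing A K] : Module.Finite A (integralClosure A K) := by
  set V := integralClosure A K
  have := isNoetherianRing_integralClosure A K
  obtain ⟨x, hxm, hx⟩ := Submodule.exists_mem_ne_zero_of_ne_bot
    (isField_iff_maximalIdeal_eq.not.mp hA)
  have hfin := finite_quotient_smul_top (V := V) V.val.toLinearMap Subtype.val_injective hx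
  obtain ⟨s, hs⟩ := hfin.fg_top
  classical
  choose f hf using Submodule.mkQ_surjective (x • ⊤ : Submodule A V)
  set N : Submodule A V := Submodule.span A (s.image f : Finset V) with hN
  have hNfin : Module.Finite A N := Module.Finite.iff_fg.mpr ⟨_, rfl⟩
  have : IsPrecomplete (maximalIdeal A) N := isPrecomplete_of_finite _ _
  have : IsHausdorff (maximalIdeal A) V := by
    rw [← IsHausdorff.map_algebraMap_iff (S := V)]
    refine IsHausdorff.of_isDomain _ fun h => ?_
    have h' := map_maximalIdeal_le_jacobson (A := A) (B := V)
    rw [h, top_le_iff, Ideal.jacobson_eq_top_iff] at h'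
    exact bot_ne_top h'
  have hsurj : Function.Surjective N.subtype := by
    refine surjective_of_mkQ_comp_surjective (I := maximalIdeal A) fun q => ?_
    obtain ⟨v, rfl⟩ := Submodule.mkQ_surjective _ q
    have hv : Submodule.mkQ (x • ⊤ : Submodule A V) v ∈
        N.map (Submodule.mkQ (x • ⊤ : Submodule A V)) := by
      have : N.map (Submodule.mkQ (x • ⊤ : Submodule A V)) = ⊤ := by
        rw [hN, Submodule.map_span, ← hs, eq_comm]
        congr 1
        ext q
        simp only [Finset.coe_image, Set.mem_image, exists_exists_and_eq_and, hf,
          exists_eq_right]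
      rw [this]; trivial
    obtain ⟨n, hn, hnv⟩ := hv
    refine ⟨⟨n, hn⟩, ?_⟩
    rw [Submodule.mkQ_apply, Submodule.mkQ_apply, Submodule.Quotient.eq] at hnv
    refine (Submodule.Quotient.eq _).mpr ?_
    obtain ⟨w, -, hw⟩ := hnv
    rw [Submodule.subtype_apply, ← hw]
    exact Submodule.smul_mem_smul hxm trivial
  exact Module.Finite.of_surjective N.subtype hsurj

theorem isDiscreteValuationRing_integralClosure (hA : ¬ IsField A) (K : Type*) [Field K]
    [Algebra A K] [IsFractionRing A K] : IsDiscreteValuationRing (integralClosure A K) := by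
  have := isNoetherianRing_integralClosure A K
  have : IsLocalRing (integralClosure A K) := isLocalRing_of_isIntegral (A := A)
  have hinj : Function.Injective (algebraMap A (integralClosure A K)) :=
    FaithfulSMul.algebraMap_injective _ _
  have hV : ¬ IsField (integralClosure A K) := fun h =>
    hA (isField_of_isIntegral_of_isField hinj h)
  have : IsIntegrallyClosed (integralClosure A K) :=
    integralClosure.isIntegrallyClosedOfFiniteExtension K
  -- The characterization used is: integrally closed with exactly one nonzero prime.
  have htfae := (IsDiscreteValuationRing.TFAE (integralClosure A K) hV).out 0 3
  refine htfae.mpr ⟨inferInstance, maximalIdeal _,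
    ⟨isField_iff_maximalIdeal_eq.not.mp hV, inferInstance⟩, fun Q hQ => ?_⟩
  refine eq_maximalIdeal ?_
  have := hQ.2
  refine Ideal.isMaximal_of_isIntegral_of_isMaximal_comap (R := A) Q ?_
  refine Ideal.IsPrime.isMaximal_of_ne_bot ?_ ?_
  · infer_instance
  · obtain ⟨y, hy, hy0⟩ := Submodule.exists_mem_ne_zero_of_ne_bot hQ.1
    exact Ideal.comap_ne_bot_of_integral_mem (R := A) hy0 hy (Algebra.IsIntegral.isIntegral y)

end Normalization

/-! ### The normalized valuation of a branch. -/

section NormVal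

open IsLocalRing

universe u

variable {A : Type u} [CommRing A] [IsDomain A]

theorem normVal_lt_one_iff [h : IsDiscreteValuationRing (integralClosure A (FractionRing A))]
    (v : integralClosure A (FractionRing A)) :
    normVal A (v : FractionRing A) < 1 ↔ v ∈ maximalIdeal (integralClosure A (FractionRing A)) := by
  have : IsFractionRing (integralClosure A (FractionRing A)) (FractionRing A) :=
    integralClosure.isFractionRing_of_finite_extension (FractionRing A) (FractionRing A)
  rw [normVal, dif_pos h]
  exact IsDedekindDomain.HeightOneSpectrum.valuation_lt_one_iff_mem _ v

theorem normVal_coe_le_one [h : IsDiscreteValuationRing (integralClosure A (FractionRing A))]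
    (v : integralClosure A (FractionRing A)) : normVal A (v : FractionRing A) ≤ 1 := by
  have : IsFractionRing (integralClosure A (FractionRing A)) (FractionRing A) :=
    integralClosure.isFractionRing_of_finite_extension (FractionRing A) (FractionRing A)
  rw [normVal, dif_pos h]
  exact IsDedekindDomain.HeightOneSpectrum.valuation_le_one _ v

theorem normVal_le_one_iff [h : IsDiscreteValuationRing (integralClosure A (FractionRing A))]
    (x : FractionRing A) : normVal A x ≤ 1 ↔ x ∈ integralClosure A (FractionRing A) := by
  refine ⟨fun hx => ?_, fun hx => normVal_coe_le_one ⟨x, hx⟩⟩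
  have : IsFractionRing (integralClosure A (FractionRing A)) (FractionRing A) :=
    integralClosure.isFractionRing_of_finite_extension (FractionRing A) (FractionRing A)
  rcases ValuationRing.isInteger_or_isInteger (integralClosure A (FractionRing A)) x with
    ⟨y, rfl⟩ | ⟨y, hy⟩
  · exact y.2
  · by_cases hyu : IsUnit y
    · obtain ⟨z, hz⟩ := hyu.exists_right_inv
      have hyz : x⁻¹ * (z : FractionRing A) = 1 := by
        rw [← hy]; exact congrArg Subtype.val hz
      exact eq_of_inv_mul_eq_one hyz ▸ z.2
    · have hlt := (normVal_lt_one_iff y).mpr hyu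
      rw [show (y : FractionRing A) = x⁻¹ from hy, map_inv₀] at hlt
      by_cases hx0 : x = 0
      · rw [hx0]; exact zero_mem _
      · rw [inv_lt_one₀ (zero_lt_iff.mpr ((Valuation.ne_zero_iff _).mpr hx0))] at hlt
        exact absurd hx (not_le.mpr hlt)

theorem exists_normVal_eq [h : IsDiscreteValuationRing (integralClosure A (FractionRing A))]
    (n : ℤ) : ∃ x, normVal A x = WithZero.exp n := by
  have : IsFractionRing (integralClosure A (FractionRing A)) (FractionRing A) :=
    integralClosure.isFractionRing_of_finite_extension (FractionRing A) (FractionRing A)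
  obtain ⟨x, hx⟩ := IsDedekindDomain.HeightOneSpectrum.valuation_exists_uniformizer
    (FractionRing A) (IsDiscreteValuationRing.maximalIdeal (integralClosure A (FractionRing A)))
  -- A uniformizer has value `exp (-1)`, whence the sign.
  refine ⟨x ^ (-n), ?_⟩
  rw [normVal, dif_pos h, map_zpow₀, hx, ← WithZero.exp_zsmul]
  simp

end NormVal

end Colength

namespace Colength

/-! ### The total ring of fractions as the product of the branch fields. -/

section TotalFractions

universe u

variable {R : Type u} [CommRing R] {r : ℕ} (P : Fin r ≃ minimalPrimes R)

theorem exists_notMem_and_forall_mem (i : Fin r) :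
    ∃ s : R, s ∉ (P i).1 ∧ ∀ j, j ≠ i → s ∈ (P j).1 := by
  have h : ∀ j, ∃ t : R, t ∉ (P i).1 ∧ (j ≠ i → t ∈ (P j).1) := by
    intro j
    by_cases hj : j = i
    · exact ⟨1, (Ideal.ne_top_iff_one _).mp (P i).2.1.1.ne_top, fun h => absurd hj h⟩
    · have : ¬ (P j).1 ≤ (P i).1 := fun hle =>
        hj (P.injective (Subtype.ext (le_antisymm hle ((P i).2.2 (P j).2.1 hle))))
      obtain ⟨t, ht, ht'⟩ := Set.not_subset.mp this
      exact ⟨t, ht', fun _ => ht⟩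
  choose t ht ht' using h
  refine ⟨∏ j, t j, fun hm => ?_, fun j hj => ?_⟩
  · obtain ⟨j, -, hj⟩ := (P i).2.1.1.prod_mem_iff.mp hm
    exact ht j hj
  · exact Ideal.mem_of_dvd _ (Finset.dvd_prod_of_mem t (Finset.mem_univ j)) (ht' j hj)

theorem projBranch_algebraMap (i : Fin r) (a : R) :
    projBranch P i (algebraMap R (FractionRing R) a) =
      algebraMap (BranchRing P i) (BranchField P i) (Ideal.Quotient.mk _ a) :=
  IsLocalization.map_eq _ _

theorem projBranch_algebraMap_eq_zero_iff (i : Fin r) (a : R) :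
    projBranch P i (algebraMap R (FractionRing R) a) = 0 ↔ a ∈ (P i).1 := by
  rw [projBranch_algebraMap, IsFractionRing.to_map_eq_zero_iff, Ideal.Quotient.eq_zero_iff_mem]

theorem projPartial_algebraMap (J : Finset (Fin r)) (a : R) :
    projPartial P J (algebraMap R (FractionRing R) a) =
      algebraMap (PartialRing P J) (PartialFrac P J) (Ideal.Quotient.mk _ a) :=
  IsLocalization.map_eq (regular_le_comap_partial P J) a

theorem projPartialBranch_algebraMap (J : Finset (Fin r)) (j : J) (a : PartialRing P J) :
    projPartialBranch P J j (algebraMap (PartialRing P J) (PartialFrac P J) a) =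
      algebraMap (BranchRing P j) (BranchField P j)
        (Ideal.Quotient.factor (interIdeal_le P j.2) a) :=
  IsLocalization.map_eq _ _

theorem projPartialBranch_projPartial (J : Finset (Fin r)) (j : J) (x : FractionRing R) :
    projPartialBranch P J j (projPartial P J x) = projBranch P j x := by
  have : (projPartialBranch P J j).comp (projPartialHom P J) = projBranch P j := by
    refine IsLocalization.ringHom_ext R⁰ (RingHom.ext fun a => ?_)
    refine Eq.trans ?_ (projBranch_algebraMap P j a).symm
    refine (congrArg (projPartialBranch P J j) (projPartial_algebraMap P J a)).trans ?_
    rw [projPartialBranch_algebraMap, Ideal.Quotient.factor_mk]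
  exact RingHom.congr_fun this x

theorem partialVal_projPartial (J : Finset (Fin r)) (j : J) (x : FractionRing R) :
    partialVal P J j (projPartial P J x) = val P j x := by
  rw [partialVal, Valuation.comap_apply, projPartialBranch_projPartial, val,
    Valuation.comap_apply]

theorem eq_zero_of_projPartialBranch_eq_zero (J : Finset (Fin r)) (x : PartialFrac P J)
    (hx : ∀ j, projPartialBranch P J j x = 0) : x = 0 := by
  obtain ⟨⟨a, s⟩, has⟩ := IsLocalization.surj (PartialRing P J)⁰ x
  obtain ⟨a, rfl⟩ := Ideal.Quotient.mk_surjective a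
  have ha : Ideal.Quotient.mk (interIdeal P J) a = 0 := by
    rw [Ideal.Quotient.eq_zero_iff_mem]
    simp only [Submodule.mem_iInf]
    intro j hj
    have h := congrArg (projPartialBranch P J ⟨j, hj⟩) has
    rw [map_mul, hx, zero_mul] at h
    dsimp only at h
    rw [projPartialBranch_algebraMap, Ideal.Quotient.factor_mk, eq_comm,
      IsFractionRing.to_map_eq_zero_iff, Ideal.Quotient.eq_zero_iff_mem] at h
    exact h
  dsimp only at has
  rw [ha, map_zero] at has
  exact (IsLocalization.map_units (PartialFrac P J) s).mul_left_eq_zero.mp has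

theorem mem_nonZeroDivisors_partialFrac_iff (J : Finset (Fin r)) (x : PartialFrac P J) :
    x ∈ (PartialFrac P J)⁰ ↔ ∀ j, projPartialBranch P J j x ≠ 0 := by
  constructor
  · intro hx j
    exact (((IsFractionRing.nonZeroDivisors_eq_isUnit (PartialRing P J) (PartialFrac P J)).le hx :
      IsUnit x).map (projPartialBranch P J j)).ne_zero
  · intro hx
    rw [mem_nonZeroDivisors_iff_right]
    intro y hy
    refine eq_zero_of_projPartialBranch_eq_zero P J y fun j => ?_
    have h := congrArg (projPartialBranch P J j) hy
    rw [map_mul, map_zero] at h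
    exact (mul_eq_zero.mp h).resolve_right (hx j)

theorem projPartial_mem_nonZeroDivisors_iff (J : Finset (Fin r)) (x : FractionRing R) :
    projPartial P J x ∈ (PartialFrac P J)⁰ ↔ ∀ j ∈ J, val P j x ≠ 0 := by
  rw [mem_nonZeroDivisors_partialFrac_iff]
  simp only [projPartialBranch_projPartial, val, Valuation.comap_apply, Valuation.ne_zero_iff]
  exact ⟨fun h j hj => h ⟨j, hj⟩, fun h j => h j j.2⟩

variable [IsReduced R]

theorem eq_zero_of_forall_mem {x : R} (hx : ∀ i, x ∈ (P i).1) : x = 0 := by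
  have : x ∈ sInf (minimalPrimes R) := by
    rw [Submodule.mem_sInf]
    intro p hp
    simpa using hx (P.symm ⟨p, hp⟩)
  have h : x ∈ (⊥ : Ideal R).radical := by rw [← Ideal.sInf_minimalPrimes]; exact this
  rw [Ideal.radical_bot_of_isReduced] at h
  exact h

theorem mem_nonZeroDivisors_iff_notMem {x : R} : x ∈ R⁰ ↔ ∀ i, x ∉ (P i).1 := by
  refine ⟨fun hx i => regular_notMem P i hx, fun hx => ?_⟩
  rw [mem_nonZeroDivisors_iff_right]
  intro y hy
  refine eq_zero_of_forall_mem P fun i => ?_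
  refine ((P i).2.1.1.mem_or_mem (x := y) (y := x) ?_).resolve_right (hx i)
  rw [hy]; exact zero_mem _

theorem eq_zero_of_projBranch_eq_zero {x : FractionRing R} (hx : ∀ i, projBranch P i x = 0) :
    x = 0 := by
  obtain ⟨⟨a, s⟩, has⟩ := IsLocalization.surj R⁰ x
  have ha : a = 0 := by
    refine eq_zero_of_forall_mem P fun i => ?_
    have h := congrArg (projBranch P i) has
    rw [map_mul, hx, zero_mul] at h
    exact (projBranch_algebraMap_eq_zero_iff P i a).mp h.symm
  dsimp only at has
  rw [ha, map_zero] at has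
  exact (IsLocalization.map_units (FractionRing R) s).mul_left_eq_zero.mp has

theorem eq_of_projBranch_eq {x y : FractionRing R}
    (hx : ∀ i, projBranch P i x = projBranch P i y) : x = y :=
  sub_eq_zero.mp (eq_zero_of_projBranch_eq_zero P fun i => by rw [map_sub, hx, sub_self])

theorem mem_nonZeroDivisors_fractionRing_iff (x : FractionRing R) :
    x ∈ (FractionRing R)⁰ ↔ ∀ i, val P i x ≠ 0 := by
  simp only [val, Valuation.comap_apply, Valuation.ne_zero_iff]
  constructor
  · intro hx j
    exact (((IsFractionRing.nonZeroDivisors_eq_isUnit R (FractionRing R)).le hx :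
      IsUnit x).map (projBranch P j)).ne_zero
  · intro hx
    rw [mem_nonZeroDivisors_iff_right]
    intro y hy
    refine eq_zero_of_projBranch_eq_zero P fun j => ?_
    have h := congrArg (projBranch P j) hy
    rw [map_mul, map_zero] at h
    exact (mul_eq_zero.mp h).resolve_right (hx j)

/-- With `z i = a i / b i` and `s i` lying in every minimal prime except the `i`-th, the fraction `∑
s j * a j / ∑ s j * b j` works, since only the `i`-th terms survive on branch `i`. Its denominator
avoids all minimal primes, hence is regular in the reduced ring `R`. -/
theorem exists_projBranch_eq (z : ∀ i, BranchField P i) : ∃ x, ∀ i, projBranch P i x = z i := by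
  choose s hs hs' using exists_notMem_and_forall_mem P
  have hz : ∀ i, ∃ a b : R, b ∉ (P i).1 ∧ z i * projBranch P i (algebraMap R _ b) =
      projBranch P i (algebraMap R _ a) := by
    intro i
    obtain ⟨⟨a, b⟩, hab⟩ := IsLocalization.surj (BranchRing P i)⁰ (z i)
    obtain ⟨a, rfl⟩ := Ideal.Quotient.mk_surjective a
    obtain ⟨b', hb'⟩ := Ideal.Quotient.mk_surjective b.1
    refine ⟨a, b', ?_, ?_⟩
    · rw [← Ideal.Quotient.eq_zero_iff_mem, hb']
      exact nonZeroDivisors.ne_zero b.2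
    · rw [projBranch_algebraMap, projBranch_algebraMap, hb']
      exact hab
  choose a b hb hab using hz
  have hsum : ∀ (c : Fin r → R) (i : Fin r), ∑ j, s j * c j - s i * c i ∈ (P i).1 := by
    intro c i
    rw [← Finset.add_sum_erase _ _ (Finset.mem_univ i), add_sub_cancel_left]
    exact Ideal.sum_mem _ fun j hj =>
      Ideal.mul_mem_right _ _ (hs' j i (Finset.ne_of_mem_erase hj).symm)
  have hproj : ∀ (c : Fin r → R) (i : Fin r),
      projBranch P i (algebraMap R (FractionRing R) (∑ j, s j * c j)) =
        projBranch P i (algebraMap R _ (s i)) * projBranch P i (algebraMap R _ (c i)) := by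
    intro c i
    rw [← map_mul, ← map_mul, ← sub_eq_zero, ← map_sub, ← map_sub,
      projBranch_algebraMap_eq_zero_iff]
    exact hsum c i
  have hreg : ∑ j, s j * b j ∈ R⁰ := by
    rw [mem_nonZeroDivisors_iff_notMem P]
    intro i hi
    rw [← projBranch_algebraMap_eq_zero_iff, hproj, mul_eq_zero,
      projBranch_algebraMap_eq_zero_iff, projBranch_algebraMap_eq_zero_iff] at hi
    exact hi.elim (hs i) (hb i)
  refine ⟨IsLocalization.mk' (FractionRing R) (∑ j, s j * a j) ⟨_, hreg⟩, fun i => ?_⟩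
  have h := congrArg (projBranch P i) (IsLocalization.mk'_spec (FractionRing R)
    (∑ j, s j * a j) (⟨_, hreg⟩ : R⁰))
  rw [map_mul, hproj, hproj, ← hab] at h
  have h0 : projBranch P i (algebraMap R _ (s i)) * projBranch P i (algebraMap R _ (b i)) ≠ 0 := by
    rw [Ne, mul_eq_zero, projBranch_algebraMap_eq_zero_iff, projBranch_algebraMap_eq_zero_iff]
    exact not_or.mpr ⟨hs i, hb i⟩
  refine mul_right_cancel₀ h0 (h.trans (by ring))

end TotalFractions

end Colength

/-! ### From complete admissible rings to branch systems. -/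

namespace Colength

open IsLocalRing

universe u

/-- A family of discrete valuations on the total ring of fractions `K` of a local ring `R`, having
the residue field of `R` as their common residue field and splitting `K` into a product. -/
structure IsBranchSystem (R : Type*) {K : Type*} [CommRing R] [IsLocalRing R] [CommRing K]
    [Algebra R K] {ι : Type*} (w : ι → Valuation K ℤᵐ⁰) : Prop where
  le_one : ∀ i (a : R), w i (algebraMap R K a) ≤ 1
  lt_one : ∀ i, ∀ a ∈ maximalIdeal R, w i (algebraMap R K a) < 1
  residue : ∀ i x y, w i x = w i y → w i y ≠ 0 → ∃ a : R, w i (x - a • y) < w i y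
  proj : ∀ i, ∃ e : K, w i (1 - e) = 0 ∧ ∀ j, j ≠ i → w j e = 0
  value : ∀ i (n : ℤ), ∃ x, w i x = WithZero.exp n
  card : ENat.card ι ≤ ENat.card (ResidueField R)

section Admissible

theorem map_mk_maximalIdeal {R : Type*} [CommRing R] [IsLocalRing R] (I : Ideal R)
    [IsLocalRing (R ⧸ I)] :
    (maximalIdeal R).map (algebraMap R (R ⧸ I)) = maximalIdeal (R ⧸ I) := by
  refine eq_maximalIdeal ((Ideal.map_eq_top_or_isMaximal_of_surjective _
    Ideal.Quotient.mk_surjective inferInstance).resolve_left fun (h : _ = _) => ?_)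
  have : (maximalIdeal R).map (Ideal.Quotient.mk I) ≤ _ :=
    map_maximalIdeal_le_jacobson (A := R) (B := R ⧸ I)
  rw [h, top_le_iff, Ideal.jacobson_eq_top_iff] at this
  exact bot_ne_top this

theorem isLocalRing_branchRing {R : Type*} [CommRing R] [IsLocalRing R] {r : ℕ}
    (P : Fin r ≃ minimalPrimes R) (i : Fin r) : IsLocalRing (BranchRing P i) :=
  IsLocalRing.of_surjective' (Ideal.Quotient.mk _) Ideal.Quotient.mk_surjective

variable {R : Type u} [CommRing R] [IsLocalRing R] {r : ℕ} (P : Fin r ≃ minimalPrimes R)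

theorem IsCompleteAdmissible.isReduced (hR : IsCompleteAdmissible R) : IsReduced R := by
  have := hR.complete
  have := hR.analyticallyReduced
  refine isReduced_of_injective
    (algebraMap R (AdicCompletion (maximalIdeal R) R)) ?_
  exact AdicCompletion.of_injective (maximalIdeal R) R

theorem IsCompleteAdmissible.krullDimLE_branchRing (hR : IsCompleteAdmissible R) (i : Fin r) :
    Ring.KrullDimLE 1 (BranchRing P i) := by
  rw [Ring.krullDimLE_iff]
  refine (ringKrullDim_quotient_le _).trans ?_
  rw [hR.dim_one]; rfl

theorem IsCompleteAdmissible.isAdicComplete_branchRing (hR : IsCompleteAdmissible R) (i : Fin r)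
    [IsLocalRing (BranchRing P i)] :
    IsAdicComplete (maximalIdeal (BranchRing P i)) (BranchRing P i) := by
  have := hR.noetherian
  have := hR.complete
  have : IsPrecomplete (maximalIdeal R) (BranchRing P i) := isPrecomplete_of_finite _ _
  rw [← map_mk_maximalIdeal, IsAdicComplete.map_algebraMap_iff]
  exact { }

theorem IsCompleteAdmissible.not_isField_branchRing (hR : IsCompleteAdmissible R) (i : Fin r) : ¬
    IsField (BranchRing P i) := by
  intro h
  have hmax : (P i).1.IsMaximal := Ideal.Quotient.maximal_of_isField _ h
  obtain ⟨x, hxm, hx⟩ := hR.cohenMacaulay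
  rw [← eq_maximalIdeal hmax] at hxm
  exact regular_notMem P i hx hxm

theorem IsCompleteAdmissible.isDiscreteValuationRing (hR : IsCompleteAdmissible R) (i : Fin r) :
    IsDiscreteValuationRing (integralClosure (BranchRing P i) (BranchField P i)) := by
  have := hR.noetherian
  have := hR.krullDimLE_branchRing P i
  have := isLocalRing_branchRing P i
  have := hR.isAdicComplete_branchRing P i
  exact isDiscreteValuationRing_integralClosure _ (hR.not_isField_branchRing P i) _

theorem IsCompleteAdmissible.finite_integralClosure (hR : IsCompleteAdmissible R) (i : Fin r) :
    Module.Finite (BranchRing P i) (integralClosure (BranchRing P i) (BranchField P i)) := by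
  have := hR.noetherian
  have := hR.krullDimLE_branchRing P i
  have := isLocalRing_branchRing P i
  have := hR.isAdicComplete_branchRing P i
  exact Colength.finite_integralClosure _ (hR.not_isField_branchRing P i) _

theorem IsCompleteAdmissible.val_lt_one (hR : IsCompleteAdmissible R) (i : Fin r) {a : R}
    (ha : a ∈ maximalIdeal R) :
    val P i (algebraMap R (FractionRing R) a) < 1 := by
  have := hR.isDiscreteValuationRing P i
  have := isLocalRing_branchRing P i
  set V := integralClosure (BranchRing P i) (BranchField P i)
  rw [val, Valuation.comap_apply, projBranch_algebraMap]
  refine (normVal_lt_one_iff (algebraMap (BranchRing P i) V (Ideal.Quotient.mk _ a))).mpr ?_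
  have h1 : Ideal.Quotient.mk (P i).1 a ∈ maximalIdeal (BranchRing P i) := by
    rw [← map_mk_maximalIdeal]; exact Ideal.mem_map_of_mem _ ha
  have h2 := map_maximalIdeal_le_jacobson (A := BranchRing P i) (B := V)
    (Ideal.mem_map_of_mem _ h1)
  rwa [IsLocalRing.jacobson_eq_maximalIdeal _ bot_ne_top] at h2

/-- Every integral element of a branch lifts to an integral element of `K`. -/
theorem IsCompleteAdmissible.exists_isIntegral_projBranch_eq (hR : IsCompleteAdmissible R)
    (i : Fin r) {v : BranchField P i}
    (hv : IsIntegral (BranchRing P i) v) : ∃ x, IsIntegral R x ∧ projBranch P i x = v := by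
  have := hR.isReduced
  classical
  obtain ⟨x, hx⟩ := exists_projBranch_eq P (Pi.single i v)
  have hxi : projBranch P i x = v := by rw [hx, Pi.single_eq_same]
  refine ⟨x, ?_, hxi⟩
  obtain ⟨p, hp, hpv⟩ := isIntegral_trans (R := R) v hv
  -- The lift is `v` on branch `i`, killed by `p`, and 0 on the others, killed by the factor `X`.
  refine ⟨Polynomial.X * p, Polynomial.monic_X.mul hp, ?_⟩
  refine eq_zero_of_projBranch_eq_zero P fun j => ?_
  rw [Polynomial.eval₂_mul, Polynomial.eval₂_X, map_mul]
  by_cases hj : j = i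
  · subst hj
    rw [Polynomial.hom_eval₂, hxi]
    have : (projBranch P j).comp (algebraMap R (FractionRing R)) =
        algebraMap R (BranchField P j) := by
      ext a
      rw [RingHom.comp_apply, projBranch_algebraMap]
      rfl
    rw [this, hpv, mul_zero]
  · rw [hx, Pi.single_eq_of_ne hj, zero_mul]

/-- The integral closure of `R` in `K` surjects onto the branch normalization `V`. The residue field
of `V` is therefore one of those covered by residual rationality. -/
theorem IsCompleteAdmissible.exists_normVal_sub_lt_one (hR : IsCompleteAdmissible R) (i : Fin r)
    {v : BranchField P i}
    (hv : IsIntegral (BranchRing P i) v) : ∃ a : R,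
      normVal (BranchRing P i) (v - projBranch P i (algebraMap R (FractionRing R) a)) < 1 := by
  have := hR.isDiscreteValuationRing P i
  set V := integralClosure (BranchRing P i) (BranchField P i)
  let φ : integralClosure R (FractionRing R) →+* V :=
    ((projBranch P i).comp (integralClosure R (FractionRing R)).val.toRingHom).codRestrict V
      (fun x => IsIntegral.map_of_comp_eq (Ideal.Quotient.mk (P i).1) (projBranch P i)
        (RingHom.ext fun a => (projBranch_algebraMap P i a).symm) x.2)
  have hφ : Function.Surjective φ := by
    rintro ⟨y, hy⟩
    obtain ⟨x, hx, hxy⟩ := hR.exists_isIntegral_projBranch_eq P i hy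
    exact ⟨⟨x, hx⟩, Subtype.ext hxy⟩
  have hmax : ((maximalIdeal V).comap φ).IsMaximal :=
    Ideal.comap_isMaximal_of_surjective φ hφ
  obtain ⟨x, hx⟩ := hφ ⟨v, hv⟩
  obtain ⟨a, ha⟩ := hR.residuallyRational _ hmax (Ideal.Quotient.mk _ x)
  refine ⟨a, ?_⟩
  have hmem : x - algebraMap R _ a ∈ (maximalIdeal V).comap φ :=
    Ideal.Quotient.eq.mp ha.symm
  rw [Ideal.mem_comap, map_sub, hx] at hmem
  exact (normVal_lt_one_iff _).mpr hmem

theorem IsCompleteAdmissible.isBranchSystem (hR : IsCompleteAdmissible R) : IsBranchSystem R (val P)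
    where
  le_one := val_algebraMap_le_one P
  lt_one i _ ha := hR.val_lt_one P i ha
  residue i x y hxy hy := by
    have := hR.isDiscreteValuationRing P i
    simp only [val, Valuation.comap_apply] at hxy hy ⊢
    have hq : IsIntegral (BranchRing P i) (projBranch P i x / projBranch P i y) := by
      refine (normVal_le_one_iff _).mp ?_
      rw [map_div₀, hxy, div_self hy]
    obtain ⟨a, ha⟩ := hR.exists_normVal_sub_lt_one P i hq
    refine ⟨a, ?_⟩
    have hy0 : projBranch P i y ≠ 0 := (Valuation.ne_zero_iff _).mp hy
    have h : projBranch P i (x - a • y) = (projBranch P i x / projBranch P i y -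
        projBranch P i (algebraMap R (FractionRing R) a)) * projBranch P i y := by
      rw [Algebra.smul_def, map_sub, map_mul]
      field_simp
    rw [h, map_mul]
    exact mul_lt_of_lt_one_left (zero_lt_iff.mpr hy) ha
  proj i := by
    have := hR.isReduced
    classical
    obtain ⟨x, hx⟩ := exists_projBranch_eq P (Pi.single i 1)
    refine ⟨x, ?_, fun j hj => ?_⟩
    · rw [val, Valuation.comap_apply, map_sub, map_one, hx, Pi.single_eq_same, sub_self, map_zero]
    · rw [val, Valuation.comap_apply, hx, Pi.single_eq_of_ne hj, map_zero]
  value i n := by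
    have := hR.isReduced
    have := hR.isDiscreteValuationRing P i
    classical
    obtain ⟨y, hy⟩ := exists_normVal_eq (A := BranchRing P i) n
    obtain ⟨x, hx⟩ := exists_projBranch_eq P (Pi.single i y)
    exact ⟨x, by rw [val, Valuation.comap_apply, hx, Pi.single_eq_same, hy]⟩
  card := by
    refine le_trans (le_of_eq ?_) hR.largeResidueField
    rw [ENat.card_congr P]
    rfl

/-- The conductor of `R`. -/
theorem IsCompleteAdmissible.exists_conductor (hR : IsCompleteAdmissible R) : ∃ c : Fin r → ℤ, ∀ h :
    FractionRing R,
    (∀ i, val P i h ≤ WithZero.exp (-c i)) → ∃ a, algebraMap R (FractionRing R) a = h := by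
  have := hR.isReduced
  -- Here `b` is a common denominator of the normalization, which is finite over the branch ring.
  have hb : ∀ i, ∃ b : R, b ∉ (P i).1 ∧ ∀ v : BranchField P i, IsIntegral (BranchRing P i) v →
      ∃ a : R, projBranch P i (algebraMap R (FractionRing R) a) =
        projBranch P i (algebraMap R (FractionRing R) b) * v := by
    intro i
    have := hR.finite_integralClosure P i
    obtain ⟨b, hb, hbv⟩ := exists_smul_mem_range_of_finite (A := BranchRing P i)
      (integralClosure (BranchRing P i) (BranchField P i)).val.toLinearMap
    obtain ⟨b, rfl⟩ := Ideal.Quotient.mk_surjective b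
    refine ⟨b, ?_, fun v hv => ?_⟩
    · rw [← Ideal.Quotient.eq_zero_iff_mem]; exact nonZeroDivisors.ne_zero hb
    · obtain ⟨a, ha⟩ := hbv ⟨v, hv⟩
      obtain ⟨a, rfl⟩ := Ideal.Quotient.mk_surjective a
      refine ⟨a, ?_⟩
      rw [projBranch_algebraMap, projBranch_algebraMap, ← Algebra.smul_def]
      exact ha
  choose b hb hbv using hb
  choose s hs hs' using exists_notMem_and_forall_mem P
  have hne : ∀ i, projBranch P i (algebraMap R (FractionRing R) (s i * b i)) ≠ 0 := by
    intro i
    rw [Ne, projBranch_algebraMap_eq_zero_iff]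
    exact fun h => ((P i).2.1.1.mem_or_mem h).elim (hs i) (hb i)
  -- If the order on branch `i` is at least that of `s i * b i`, the quotient is integral there, and
  -- multiplying by `b i` puts it in the image of `R`. The factors `s i` then allow the branches to
  -- be summed without interference.
  refine ⟨fun i => -WithZero.log (val P i (algebraMap R (FractionRing R) (s i * b i))),
    fun h hh => ?_⟩
  have ha : ∀ i, ∃ a : R, projBranch P i h =
      projBranch P i (algebraMap R (FractionRing R) (s i * a)) := by
    intro i
    have := hR.isDiscreteValuationRing P i
    set t := projBranch P i (algebraMap R (FractionRing R) (s i * b i)) with ht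
    have hq : IsIntegral (BranchRing P i) (projBranch P i h / t) := by
      refine (normVal_le_one_iff _).mp ?_
      have h1 := hh i
      rw [neg_neg, WithZero.exp_log (by
        rw [val, Valuation.comap_apply, Valuation.ne_zero_iff]; exact hne i)] at h1
      rw [map_div₀]
      exact div_le_one_of_le₀ h1 zero_le
    obtain ⟨a, ha⟩ := hbv i _ hq
    refine ⟨a, ?_⟩
    rw [map_mul, map_mul, ha]
    have : t = projBranch P i (algebraMap R (FractionRing R) (s i)) *
        projBranch P i (algebraMap R (FractionRing R) (b i)) := by
      rw [ht, map_mul, map_mul]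
    rw [← mul_assoc, ← this, mul_div_cancel₀ _ (hne i)]
  choose a ha using ha
  refine ⟨∑ i, s i * a i, eq_of_projBranch_eq P fun i => ?_⟩
  rw [ha, ← sub_eq_zero, ← map_sub, ← map_sub, projBranch_algebraMap_eq_zero_iff,
    ← Finset.add_sum_erase _ _ (Finset.mem_univ i), add_sub_cancel_left]
  exact Ideal.sum_mem _ fun j hj =>
    Ideal.mul_mem_right _ _ (hs' j i (Finset.ne_of_mem_erase hj).symm)

end Admissible

end Colength

/-! ### Value sets of branch systems: infima, conductors, relative maximals. -/

namespace Colength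

open IsLocalRing

theorem lt_exp_iff_le {z : ℤᵐ⁰} {n : ℤ} : z < WithZero.exp n ↔ z ≤ WithZero.exp (n - 1) := by
  rcases eq_or_ne z 0 with rfl | hz
  · simp
  · rw [← WithZero.exp_log hz, WithZero.exp_lt_exp, WithZero.exp_le_exp]
    omega

/-- Take `α` with the smallest coordinate sum. No `α ⊓ β` has a smaller sum, so `α ⊓ β = α`. -/
theorem exists_isLeast_of_inf_mem {ι : Type*} [Fintype ι] {E : Set (ι → ℤ)} (hne : E.Nonempty)
    (hinf : ∀ α ∈ E, ∀ β ∈ E, α ⊓ β ∈ E) {b : ι → ℤ} (hb : ∀ α ∈ E, b ≤ α) :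
    ∃ α, IsLeast E α := by
  obtain ⟨m, ⟨α, hα, hm⟩, hmin⟩ := Int.exists_least_of_bdd
    (P := fun m => ∃ α ∈ E, ∑ i, α i = m)
    ⟨∑ i, b i, by rintro _ ⟨α, hα, rfl⟩; exact Finset.sum_le_sum fun i _ => hb α hα i⟩
    (by obtain ⟨α, hα⟩ := hne; exact ⟨_, α, hα, rfl⟩)
  refine ⟨α, hα, fun β hβ i => ?_⟩
  have h1 : ∑ i, α i ≤ ∑ i, (α ⊓ β) i := hm ▸ hmin _ ⟨_, hinf α hα β hβ, rfl⟩
  have h2 := (Finset.sum_eq_sum_iff_of_le fun i _ => (inf_le_left : α ⊓ β ≤ α) i).mp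
    (le_antisymm (Finset.sum_le_sum fun i _ => (inf_le_left : α ⊓ β ≤ α) i) h1) i
    (Finset.mem_univ i)
  rw [← h2]
  exact inf_le_right

theorem map_eq_one_of_map_one_sub_eq_zero {K Γ : Type*} [CommRing K]
    [LinearOrderedCommGroupWithZero Γ] (v : Valuation K Γ) {e : K} (he : v (1 - e) = 0) :
    v e = 1 := by
  have h : v (1 - (1 - e)) = 1 := by
    rw [Valuation.map_sub_eq_of_lt_left, map_one]
    rw [he, map_one]; exact zero_lt_one
  rwa [sub_sub_cancel] at h

section BranchSystem

variable {R K : Type*} [CommRing R] [IsLocalRing R] [CommRing K] [Algebra R K] {ι : Type}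
  {w : ι → Valuation K ℤᵐ⁰}

/-- The vectors of (finite) orders of the elements of `M`. -/
def orderSet (w : ι → Valuation K ℤᵐ⁰) (M : Submodule R K) : Set (ι → ℤ) :=
  {α | ∃ h ∈ M, ∀ i, w i h = WithZero.exp (-α i)}

namespace IsBranchSystem

theorem subtype (hw : IsBranchSystem R w) (J : Finset ι) : IsBranchSystem R (fun j : J => w j) where
  le_one j := hw.le_one j
  lt_one j := hw.lt_one j
  residue j := hw.residue j
  proj j := by
    obtain ⟨e, he, he'⟩ := hw.proj j
    exact ⟨e, he, fun i hi => he' i fun h => hi (Subtype.ext h)⟩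
  value j := hw.value j
  card := (ENat.card_le_card_of_injective Subtype.val_injective).trans hw.card

theorem map_smul_le (hw : IsBranchSystem R w) (i : ι) (a : R) (x : K) : w i (a • x) ≤ w i x := by
  rw [Algebra.smul_def, map_mul]
  exact mul_le_of_le_one_left' (hw.le_one i a)

theorem map_isUnit_smul (hw : IsBranchSystem R w) (i : ι) {u : R} (hu : IsUnit u) (x : K) : w i
    (u • x) = w i x := by
  obtain ⟨v, hv⟩ := hu.exists_left_inv
  refine le_antisymm (hw.map_smul_le i u x) ?_
  calc w i x = w i (v • u • x) := by rw [smul_smul, hv, one_smul]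
    _ ≤ w i (u • x) := hw.map_smul_le i v _

theorem exists_isUnit_sub_lt (hw : IsBranchSystem R w) {i : ι} {x y : K} (hxy : w i x = w i y)
    (hy : w i y ≠ 0) :
    ∃ u : R, IsUnit u ∧ w i (x - u • y) < w i y := by
  obtain ⟨a, ha⟩ := hw.residue i x y hxy hy
  refine ⟨a, ?_, ha⟩
  by_contra hu
  have h1 : w i (a • y) < w i y := by
    rw [Algebra.smul_def, map_mul]
    exact mul_lt_of_lt_one_left (zero_lt_iff.mpr hy) (hw.lt_one i a hu)
  have h2 := (w i).map_add_lt ha h1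
  rw [sub_add_cancel, hxy] at h2
  exact lt_irrefl _ h2

/-- Among the combinations `x + t • y`, with `t` running over representatives of the residue field,
each branch spoils at most one residue class: two bad classes would make `y` too small there for any
cancellation. -/
theorem exists_map_eq_max (hw : IsBranchSystem R w) [Finite ι] (x y : K) :
    ∃ a b : R, ∀ i, w i (a • x + b • y) = max (w i x) (w i y) := by
  by_contra! hcon
  have hle : ∀ (b : R) i, w i (x + b • y) ≤ max (w i x) (w i y) := fun b i =>
    ((w i).map_add _ _).trans (max_le_max le_rfl (hw.map_smul_le i b y))
  have hlt : ∀ (b : R) i, w i y < w i x → w i (x + b • y) = max (w i x) (w i y) := by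
    intro b i h
    rw [max_eq_left h.le]
    exact Valuation.map_add_eq_of_lt_left _ ((hw.map_smul_le i b y).trans_lt h)
  -- The failure of `y` itself yields a branch where `x` dominates, which spoils no class. This
  -- gains one branch, so a residue field with as many elements as branches suffices.
  obtain ⟨i₀, hi₀⟩ := hcon 0 1
  simp only [zero_smul, one_smul, zero_add] at hi₀
  have hi₀' : w i₀ y < w i₀ x := by
    by_contra h
    exact hi₀ (max_eq_right (not_lt.mp h)).symm
  choose t ht using residue_surjective (R := R)
  have hbad : ∀ k : ResidueField R, ∃ i, w i (x + t k • y) < max (w i x) (w i y) := by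
    intro k
    obtain ⟨i, hi⟩ := hcon 1 (t k)
    rw [one_smul] at hi
    exact ⟨i, lt_of_le_of_ne (hle _ i) hi⟩
  choose f hf using hbad
  have hinj : Function.Injective f := by
    intro k k' hkk
    by_contra hne
    have h1 := hf k
    have h2 := hf k'
    rw [← hkk] at h2
    have hu : IsUnit (t k - t k') := by
      rw [← residue_ne_zero_iff_isUnit, map_sub, ht, ht]
      exact sub_ne_zero.mpr hne
    have h3 : w (f k) y < max (w (f k) x) (w (f k) y) := by
      rw [← hw.map_isUnit_smul (f k) hu y]
      have h := (w (f k)).map_sub_lt h1 h2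
      rw [add_sub_add_left_eq_sub, ← sub_smul] at h
      rwa [hw.map_isUnit_smul (f k) hu y] at h ⊢
    have h4 : w (f k) y < w (f k) x := (lt_max_iff.mp h3).resolve_right (lt_irrefl _)
    exact absurd (hlt (t k) (f k) h4) h1.ne
  have hmiss : i₀ ∉ Set.range f := by
    rintro ⟨k, rfl⟩
    exact absurd (hlt (t k) (f k) hi₀') (hf k).ne
  have : Finite (ResidueField R) := Finite.of_injective f hinj
  have hcard := hw.card
  rw [ENat.card_eq_coe_natCard, ENat.card_eq_coe_natCard, Nat.cast_le] at hcard
  have hsurj := (Function.Injective.bijective_of_nat_card_le hinj hcard).2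
  exact hmiss (hsurj i₀)

theorem exists_mem_map_eq_max (hw : IsBranchSystem R w) [Finite ι] {M : Submodule R K} {x y : K}
    (hx : x ∈ M) (hy : y ∈ M) :
    ∃ z ∈ M, ∀ i, w i z = max (w i x) (w i y) := by
  obtain ⟨a, b, h⟩ := hw.exists_map_eq_max x y
  exact ⟨_, M.add_mem (M.smul_mem a hx) (M.smul_mem b hy), h⟩

theorem inf_mem_orderSet (hw : IsBranchSystem R w) [Finite ι] {M : Submodule R K} {α β : ι → ℤ}
    (hα : α ∈ orderSet w M)
    (hβ : β ∈ orderSet w M) : α ⊓ β ∈ orderSet w M := by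
  obtain ⟨x, hx, hxα⟩ := hα
  obtain ⟨y, hy, hyβ⟩ := hβ
  obtain ⟨z, hz, hzw⟩ := hw.exists_mem_map_eq_max hx hy
  refine ⟨z, hz, fun i => ?_⟩
  rw [hzw, hxα, hyβ, Pi.inf_apply]
  rcases le_total (α i) (β i) with h | h
  · rw [max_eq_left (WithZero.exp_le_exp.mpr (neg_le_neg h)), inf_eq_left.mpr h]
  · rw [max_eq_right (WithZero.exp_le_exp.mpr (neg_le_neg h)), inf_eq_right.mpr h]

theorem exists_map_eq_exp_and_zero (hw : IsBranchSystem R w) (i : ι) (n : ℤ) :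
    ∃ x, w i x = WithZero.exp n ∧ ∀ j, j ≠ i → w j x = 0 := by
  obtain ⟨e, he, he'⟩ := hw.proj i
  obtain ⟨x, hx⟩ := hw.value i n
  refine ⟨e * x, ?_, fun j hj => ?_⟩
  · rw [map_mul, map_eq_one_of_map_one_sub_eq_zero _ he, one_mul, hx]
  · rw [map_mul, he' j hj, zero_mul]

theorem exists_map_eq_exp (hw : IsBranchSystem R w) [Fintype ι] (α : ι → ℤ) : ∃ x, ∀ i, w i x =
    WithZero.exp (α i) := by
  classical
  choose x hx hx' using fun i => hw.exists_map_eq_exp_and_zero i (α i)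
  refine ⟨∑ i, x i, fun i => ?_⟩
  rw [← Finset.add_sum_erase _ _ (Finset.mem_univ i), Valuation.map_add_eq_of_lt_left, hx]
  rw [hx]
  refine (w i).map_sum_lt WithZero.exp_ne_zero fun j hj => ?_
  rw [hx' j i (Finset.ne_of_mem_erase hj).symm]
  exact WithZero.exp_pos

/-- A conductor of the value set is a conductor of the module. -/
theorem mem_of_le_conductor (hw : IsBranchSystem R w) [Fintype ι] {M : Submodule R K} {c' : ι → ℤ}
    (hc' : ∀ h, (∀ i, w i h ≤ WithZero.exp (-c' i)) → h ∈ M) {c : ι → ℤ}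
    (hc : ∀ β, c ≤ β → β ∈ orderSet w M) {h : K} (hh : ∀ i, w i h ≤ WithZero.exp (-c i)) :
    h ∈ M := by
  classical
  -- Raise the bound `d` from `c` towards `c ⊔ c'` one coordinate at a time. As `d ≥ c`, some `g` in
  -- `M` has orders exactly `d`, and subtracting a unit multiple of `g` cancels the leading term on
  -- the chosen branch.
  have key : ∀ (n : ℕ) (d : ι → ℤ), c ≤ d → d ≤ c ⊔ c' → ∑ i, ((c ⊔ c') i - d i) = n →
      ∀ h, (∀ i, w i h ≤ WithZero.exp (-d i)) → h ∈ M := by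
    intro n
    induction n with
    | zero =>
      intro d _ hd' hsum h hh
      have hz := (Finset.sum_eq_zero_iff_of_nonneg fun i _ => sub_nonneg.mpr (hd' i)).mp
        (by simpa using hsum)
      refine hc' h fun i => (hh i).trans ?_
      rw [WithZero.exp_le_exp, neg_le_neg_iff]
      have := hz i (Finset.mem_univ i)
      have h2 : c' i ≤ (c ⊔ c') i := le_sup_right
      omega
    | succ n ih =>
      intro d hd hd' hsum h hh
      obtain ⟨i, -, hi⟩ : ∃ i ∈ Finset.univ, 0 < (c ⊔ c') i - d i := by
        apply Finset.exists_lt_of_sum_lt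
        rw [hsum, Finset.sum_const_zero]
        positivity
      have hstep : ∀ h, (∀ i, w i h ≤ WithZero.exp (-d i)) → w i h < WithZero.exp (-d i) →
          h ∈ M := by
        intro h hh hlt
        refine ih (Function.update d i (d i + 1)) ?_ ?_ ?_ h ?_
        · intro j
          rcases eq_or_ne j i with rfl | hj
          · rw [Function.update_self]; exact (hd j).trans (Int.le_add_one le_rfl)
          · rw [Function.update_of_ne hj]; exact hd j
        · intro j
          rcases eq_or_ne j i with rfl | hj
          · rw [Function.update_self]; exact Int.add_one_le_of_lt (sub_pos.mp hi)
          · rw [Function.update_of_ne hj]; exact hd' j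
        · rw [← Finset.add_sum_erase _ _ (Finset.mem_univ i)] at hsum ⊢
          rw [Function.update_self, Finset.sum_congr rfl fun j hj => by
            rw [Function.update_of_ne (Finset.ne_of_mem_erase hj)]]
          push_cast at hsum
          omega
        · intro j
          rcases eq_or_ne j i with rfl | hj
          · rw [Function.update_self, neg_add', ← lt_exp_iff_le]; exact hlt
          · rw [Function.update_of_ne hj]; exact hh j
      rcases (hh i).lt_or_eq with hlt | heq
      · exact hstep h hh hlt
      · obtain ⟨g, hg, hgd⟩ := hc d hd
        obtain ⟨u, -, hu⟩ := hw.exists_isUnit_sub_lt (heq.trans (hgd i).symm)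
          (by rw [hgd]; exact WithZero.exp_ne_zero)
        have := hstep (h - u • g) (fun j => (w j).map_sub_le (hh j)
          ((hw.map_smul_le j u g).trans (hgd j).le)) (hu.trans_eq (hgd i))
        simpa using M.add_mem this (M.smul_mem u hg)
  have hnn : 0 ≤ ∑ i, ((c ⊔ c') i - c i) :=
    Finset.sum_nonneg fun i _ => sub_nonneg.mpr ((le_sup_left : c ≤ c ⊔ c') i)
  exact key (∑ i, ((c ⊔ c') i - c i)).toNat c le_rfl le_sup_left
    (Int.toNat_of_nonneg hnn).symm h hh

/-- A criterion for relative maximals. -/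
theorem mem_relMaximals (hw : IsBranchSystem R w) [Finite ι] {M : Submodule R K}
    (hbig : ∀ N : ι → ℤ, ∃ α ∈ orderSet w M, N ≤ α) {r : ι} {β : ι → ℤ}
    (hmax : ∀ h ∈ M, w r h = WithZero.exp (-β r) → ∃ j, j ≠ r ∧ WithZero.exp (-β j) ≤ w j h)
    (hpair : ∀ j, j ≠ r → ∃ g ∈ M, w r g = WithZero.exp (-β r) ∧ w j g = WithZero.exp (-β j) ∧
      ∀ i, i ≠ r → i ≠ j → w i g < WithZero.exp (-β i)) (hr : ∃ j, j ≠ r) :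
    β ∈ relMaximals (orderSet w M) := by
  classical
  -- A version of the fiber in which infinite orders are allowed off `T`, as differences may vanish
  -- on a branch. In `hfib`, combining with an element of large finite orders restores a genuine
  -- fiber point.
  let Fib : Finset ι → Prop := fun T => ∃ h ∈ M, (∀ j ∈ T, w j h = WithZero.exp (-β j)) ∧
    ∀ j ∉ T, w j h < WithZero.exp (-β j)
  have hunion : ∀ S T, Fib S → Fib T → Fib (S ∪ T) := by
    rintro S T ⟨x, hx, hxS, hxS'⟩ ⟨y, hy, hyT, hyT'⟩
    obtain ⟨z, hz, hzw⟩ := hw.exists_mem_map_eq_max hx hy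
    have hxle : ∀ j, w j x ≤ WithZero.exp (-β j) := fun j => by
      by_cases hj : j ∈ S
      · exact (hxS j hj).le
      · exact (hxS' j hj).le
    have hyle : ∀ j, w j y ≤ WithZero.exp (-β j) := fun j => by
      by_cases hj : j ∈ T
      · exact (hyT j hj).le
      · exact (hyT' j hj).le
    refine ⟨z, hz, fun j hj => ?_, fun j hj => ?_⟩
    · rw [hzw]
      rcases Finset.mem_union.mp hj with h | h
      · rw [hxS j h, max_eq_left (hyle j)]
      · rw [hyT j h, max_eq_right (hxle j)]
    · rw [hzw]
      rw [Finset.mem_union, not_or] at hj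
      exact max_lt (hxS' j hj.1) (hyT' j hj.2)
  have hfib : ∀ T, Fib T → (fiber T (orderSet w M) β).Nonempty := by
    rintro T ⟨x, hx, hxT, hxT'⟩
    obtain ⟨α, ⟨y, hy, hyα⟩, hα⟩ := hbig (β + 1)
    obtain ⟨z, hz, hzw⟩ := hw.exists_mem_map_eq_max hx hy
    have hlt : ∀ i, w i y < WithZero.exp (-β i) := fun i => by
      rw [hyα, WithZero.exp_lt_exp, neg_lt_neg_iff]
      exact Int.lt_of_add_one_le (hα i)
    have hne : ∀ i, w i z ≠ 0 := fun i h => by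
      rw [hzw, hyα] at h
      exact absurd (h ▸ le_max_right (w i x) (WithZero.exp (-α i))) (not_le.mpr WithZero.exp_pos)
    refine ⟨fun i => -WithZero.log (w i z), ⟨z, hz, fun i => ?_⟩, fun j hj => ?_, fun j hj => ?_⟩
    · rw [neg_neg, WithZero.exp_log (hne i)]
    · dsimp only
      rw [hzw, hxT j hj, max_eq_left (hlt j).le, WithZero.log_exp, neg_neg]
    · have h : w j z < WithZero.exp (-β j) := by
        rw [hzw]; exact max_lt (hxT' j hj) (hlt j)
      rw [← WithZero.exp_log (hne j), WithZero.exp_lt_exp] at h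
      dsimp only
      omega
  have hpairs : ∀ i j, i ≠ j → Fib {i, j} := by
    have h1 : ∀ j, j ≠ r → Fib {r, j} := by
      intro j hj
      obtain ⟨g, hg, hgr, hgj, hgo⟩ := hpair j hj
      refine ⟨g, hg, fun i hi => ?_, fun i hi => ?_⟩
      · rw [Finset.mem_insert, Finset.mem_singleton] at hi
        rcases hi with rfl | rfl
        · exact hgr
        · exact hgj
      · rw [Finset.mem_insert, Finset.mem_singleton, not_or] at hi
        exact hgo i hi.1 hi.2
    intro i j hij
    by_cases hi : i = r
    · subst hi; exact h1 j hij.symm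
    by_cases hj : j = r
    · subst hj; rw [Finset.pair_comm]; exact h1 i hi
    obtain ⟨x, hx, hxr, hxi, hxo⟩ := hpair i hi
    obtain ⟨y, hy, hyr, hyj, hyo⟩ := hpair j hj
    -- Cancelling leading terms on branch `r` turns witnesses for `{r, i}` and `{r, j}` into one for
    -- `{i, j}`.
    obtain ⟨u, hu, hlt⟩ := hw.exists_isUnit_sub_lt (hxr.trans hyr.symm)
      (by rw [hyr]; exact WithZero.exp_ne_zero)
    refine ⟨x - u • y, M.sub_mem hx (M.smul_mem u hy), fun k hk => ?_, fun k hk => ?_⟩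
    · rw [Finset.mem_insert, Finset.mem_singleton] at hk
      rcases hk with rfl | rfl
      · rw [Valuation.map_sub_eq_of_lt_left, hxi]
        rw [hw.map_isUnit_smul _ hu, hxi]
        exact hyo k hi hij
      · rw [Valuation.map_sub_eq_of_lt_right, hw.map_isUnit_smul _ hu, hyj]
        rw [hw.map_isUnit_smul _ hu, hyj]
        exact hxo k hj hij.symm
    · rw [Finset.mem_insert, Finset.mem_singleton, not_or] at hk
      by_cases hkr : k = r
      · subst hkr; exact hlt.trans_eq hyr
      · exact (w k).map_sub_lt (hxo k hkr hk.1)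
          (by rw [hw.map_isUnit_smul _ hu]; exact hyo k hkr hk.2)
  have hall : ∀ T : Finset ι, 2 ≤ T.card → Fib T := by
    intro T hT
    obtain ⟨t, ht⟩ := Finset.card_pos.mp (by omega : 0 < T.card)
    have hins : ∀ U : Finset ι, U.Nonempty → t ∉ U → Fib (insert t U) := by
      intro U hU
      induction hU using Finset.Nonempty.cons_induction with
      | singleton a => intro h; exact hpairs t a fun h' => h (by simp [h'])
      | cons a s ha hs ih =>
        intro h
        rw [Finset.mem_cons, not_or] at h
        have := hunion _ _ (hpairs t a h.1) (ih h.2)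
        rwa [Finset.insert_union, Finset.singleton_union, Finset.insert_comm a t s,
          Finset.insert_idem, ← Finset.cons_eq_insert a s ha] at this
    have := hins (T.erase t) (Finset.card_pos.mp (by rw [Finset.card_erase_of_mem ht]; omega))
      (Finset.notMem_erase t T)
    rwa [Finset.insert_erase ht] at this
  have := Fintype.ofFinite ι
  obtain ⟨j₀, hj₀⟩ := hr
  refine ⟨⟨?_, fun i => ?_⟩, fun J hJ => hfib J (hall J hJ)⟩
  · obtain ⟨h, hh, heq, -⟩ := hall Finset.univ (Finset.one_lt_card.mpr
      ⟨r, Finset.mem_univ _, j₀, Finset.mem_univ _, hj₀.symm⟩)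
    exact ⟨h, hh, fun i => heq i (Finset.mem_univ i)⟩
  · rw [Set.eq_empty_iff_forall_notMem]
    rintro α ⟨⟨h, hh, hα⟩, heq, hgt⟩
    have heq' : w i h = WithZero.exp (-β i) := by
      rw [hα, heq i (Finset.mem_singleton_self i)]
    have hlt' : ∀ j, j ≠ i → w j h < WithZero.exp (-β j) := fun j hj => by
      rw [hα, WithZero.exp_lt_exp, neg_lt_neg_iff]
      exact hgt j (by rwa [Finset.mem_singleton])
    by_cases hi : i = r
    · subst hi
      obtain ⟨j, hj, hle⟩ := hmax h hh heq'
      exact absurd (hlt' j hj) (not_lt.mpr hle)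
    -- Cancelling `h` on branch `i` against the witness for `{r, i}` leaves order `β r` on `r` and
    -- larger orders elsewhere, contrary to `hmax`.
    · obtain ⟨x, hx, hxr, hxi, hxo⟩ := hpair i hi
      obtain ⟨u, hu, hlt⟩ := hw.exists_isUnit_sub_lt (hxi.trans heq'.symm)
        (by rw [heq']; exact WithZero.exp_ne_zero)
      obtain ⟨j, hj, hle⟩ := hmax (x - u • h) (M.sub_mem hx (M.smul_mem u hh)) (by
        rw [Valuation.map_sub_eq_of_lt_left, hxr]
        rw [hw.map_isUnit_smul _ hu, hxr]
        exact hlt' r (Ne.symm hi))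
      refine absurd hle (not_le.mpr ?_)
      by_cases hji : j = i
      · subst hji; exact hlt.trans_eq heq'
      · exact (w j).map_sub_lt (hxo j hj hji)
          (by rw [hw.map_isUnit_smul _ hu]; exact hlt' j hji)

end IsBranchSystem

end BranchSystem

end Colength

/-! ### Coordinates of relative maximals are the non-pure orders. -/

namespace Colength

open IsLocalRing

section LastBranch

variable {R K : Type*} [CommRing R] [IsLocalRing R] [CommRing K] [Algebra R K] {ι : Type}
  {w : ι → Valuation K ℤᵐ⁰}

/-- The orders in the branch `i` of the elements of `M`. -/
def branchOrders (w : ι → Valuation K ℤᵐ⁰) (M : Submodule R K) (i : ι) : Set ℤ :=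
  {x | ∃ h ∈ M, w i h = WithZero.exp (-x)}

/-- The orders in the branch `i` of the elements of `M` vanishing on all other branches. -/
def pureOrders (w : ι → Valuation K ℤᵐ⁰) (M : Submodule R K) (i : ι) : Set ℤ :=
  {x | ∃ h ∈ M, w i h = WithZero.exp (-x) ∧ ∀ j, j ≠ i → w j h = 0}

theorem pureOrders_subset_branchOrders {R K : Type*} [CommRing R] [CommRing K] [Algebra R K]
    {ι : Type} {w : ι → Valuation K ℤᵐ⁰} (M : Submodule R K) (i : ι) :
    pureOrders w M i ⊆ branchOrders w M i :=
  fun _ ⟨h, hh, hx, _⟩ => ⟨h, hh, hx⟩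

namespace IsBranchSystem

variable {M : Submodule R K}

/-- Choose a minimal set `S` of branches whose orders cannot all be made arbitrarily large while the
order on `r` stays `x`, then a minimal unattainable bound `δ` on `S`. Lowering one `δ j` by 1 makes
the bound attainable, with equality at `j`, and these elements are the pair witnesses required by
`mem_relMaximals`. -/
theorem exists_relMaximal (hw : IsBranchSystem R w) [Fintype ι] {b : ι → ℤ}
    (hb : ∀ h ∈ M, ∀ i, w i h ≤ WithZero.exp (b i))
    (hbig : ∀ N : ι → ℤ, ∃ α ∈ orderSet w M, N ≤ α) {r : ι} {x : ℤ}
    (hx : x ∈ branchOrders w M r) {N₀ : ℤ}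
    (hN₀ : ∀ h ∈ M, w r h = WithZero.exp (-x) → ∃ j, j ≠ r ∧ WithZero.exp (-N₀) < w j h) :
    ∃ (J : Finset ι) (hJ : {r} ⊂ J), ∃ β ∈ relMaximals (orderSet (fun j : J => w j) M),
      x = β ⟨r, hJ.1 (Finset.mem_singleton_self r)⟩ := by
  classical
  let good : Finset ι → Prop := fun S => ∀ N : ℤ, ∃ h ∈ M, w r h = WithZero.exp (-x) ∧
    ∀ j ∈ S, w j h ≤ WithZero.exp (-N)
  obtain ⟨S, ⟨hrS, hS⟩, hmin⟩ := wellFounded_lt.has_min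
    {S : Finset ι | r ∉ S ∧ ¬ good S} ⟨Finset.univ.erase r, Finset.notMem_erase _ _, fun h => by
      obtain ⟨h, hh, hr, hle⟩ := h N₀
      obtain ⟨j, hj, hlt⟩ := hN₀ h hh hr
      exact absurd (hle j (Finset.mem_erase.mpr ⟨hj, Finset.mem_univ _⟩)) (not_le.mpr hlt)⟩
  have hgood : ∀ j ∈ S, good (S.erase j) := by
    intro j hj
    by_contra hcon
    exact hmin _ ⟨fun h => hrS (Finset.mem_of_mem_erase h), hcon⟩ (Finset.erase_ssubset hj)
  have hSne : S.Nonempty := by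
    rw [Finset.nonempty_iff_ne_empty]
    rintro rfl
    obtain ⟨h, hh, hhx⟩ := hx
    exact hS fun N => ⟨h, hh, hhx, by simp⟩
  obtain ⟨N, hN⟩ : ∃ N : ℤ, ¬ ∃ h ∈ M, w r h = WithZero.exp (-x) ∧
      ∀ j ∈ S, w j h ≤ WithZero.exp (-N) := by
    by_contra! hcon
    exact hS fun N => hcon N
  let T : (ι → ℤ) → Prop := fun δ => ∃ h ∈ M, w r h = WithZero.exp (-x) ∧
    ∀ j ∈ S, w j h ≤ WithZero.exp (-δ j)
  -- Minimality of `S` bounds unattainable `δ` from below: a bound below every order on branch `j`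
  -- is vacuous, and `S.erase j` is not obstructed. The cap `N` makes this uniform.
  have hlow : ∀ δ : ι → ℤ, (∀ j ∈ S, δ j ≤ N) → ¬ T δ → ∀ j ∈ S, -b j ≤ δ j := by
    intro δ hδ hT j hj
    by_contra! hlt
    obtain ⟨h, hh, hhr, hle⟩ := hgood j hj N
    refine hT ⟨h, hh, hhr, fun i hi => ?_⟩
    by_cases hij : i = j
    · subst hij
      refine (hb h hh i).trans (WithZero.exp_le_exp.mpr ?_)
      omega
    · refine (hle i (Finset.mem_erase.mpr ⟨hij, hi⟩)).trans (WithZero.exp_le_exp.mpr ?_)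
      have := hδ i hi
      omega
  obtain ⟨m, ⟨δ, hδN, hδT, hδm⟩, hδmin⟩ := Int.exists_least_of_bdd
    (P := fun m => ∃ δ : ι → ℤ, (∀ j ∈ S, δ j ≤ N) ∧ ¬ T δ ∧ ∑ j ∈ S, δ j = m)
    ⟨∑ j ∈ S, -b j, by
      rintro _ ⟨δ, hδ, hT, rfl⟩
      exact Finset.sum_le_sum (hlow δ hδ hT)⟩ ⟨_, fun _ => N, fun _ _ => le_rfl, hN, rfl⟩
  have hpair : ∀ j ∈ S, ∃ g ∈ M, w r g = WithZero.exp (-x) ∧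
      w j g = WithZero.exp (-(δ j - 1)) ∧ ∀ i ∈ S, i ≠ j → w i g ≤ WithZero.exp (-δ i) := by
    intro j hj
    have hT : T (Function.update δ j (δ j - 1)) := by
      by_contra hcon
      have h1 := hδmin (∑ i ∈ S, Function.update δ j (δ j - 1) i) ⟨_, fun i hi => ?_, hcon, rfl⟩
      · have hs : ∑ i ∈ S.erase j, Function.update δ j (δ j - 1) i = ∑ i ∈ S.erase j, δ i :=
          Finset.sum_congr rfl fun i hi => Function.update_of_ne (Finset.ne_of_mem_erase hi) _ _
        rw [← hδm, ← Finset.add_sum_erase _ _ hj, ← Finset.add_sum_erase _ _ hj,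
          Function.update_self, hs] at h1
        omega
      · by_cases hij : i = j
        · subst hij
          rw [Function.update_self]
          have := hδN i hi
          omega
        · rw [Function.update_of_ne hij]; exact hδN i hi
    obtain ⟨g, hg, hgr, hgS⟩ := hT
    have hgo : ∀ i ∈ S, i ≠ j → w i g ≤ WithZero.exp (-δ i) := fun i hi hij => by
      have := hgS i hi
      rwa [Function.update_of_ne hij] at this
    refine ⟨g, hg, hgr, le_antisymm (by simpa using hgS j hj) ?_, hgo⟩
    by_contra! hlt
    refine hδT ⟨g, hg, hgr, fun i hi => ?_⟩
    by_cases hij : i = j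
    · subst hij
      rw [lt_exp_iff_le] at hlt
      exact hlt.trans (WithZero.exp_le_exp.mpr (by omega))
    · exact hgo i hi hij
  have hJ : {r} ⊂ insert r S := by
    rw [Finset.ssubset_iff_of_subset (by simp)]
    obtain ⟨j, hj⟩ := hSne
    exact ⟨j, Finset.mem_insert_of_mem hj, fun h => hrS (Finset.mem_singleton.mp h ▸ hj)⟩
  have hmemS : ∀ i : ↥(insert r S), i.1 ≠ r → i.1 ∈ S := fun i hi =>
    (Finset.mem_insert.mp i.2).resolve_left hi
  -- The shift by 1 turns order at least `δ i` into order strictly greater than `β i`.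
  refine ⟨insert r S, hJ, fun i => if i.1 = r then x else δ i - 1, ?_, by simp⟩
  refine (hw.subtype (insert r S)).mem_relMaximals (r := ⟨r, Finset.mem_insert_self r S⟩)
    ?_ ?_ ?_ ?_
  · intro N'
    obtain ⟨α, ⟨h, hh, hα⟩, hle⟩ := hbig fun i => if hi : i ∈ insert r S then N' ⟨i, hi⟩ else 0
    refine ⟨fun i => α i, ⟨h, hh, fun i => hα i⟩, fun i => ?_⟩
    have := hle i
    simpa only [i.2, dif_pos] using this
  · intro h hh hhr
    rw [if_pos rfl] at hhr
    by_contra! hcon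
    refine hδT ⟨h, hh, hhr, fun j hj => ?_⟩
    have hjr : j ≠ r := fun h => hrS (h ▸ hj)
    have := hcon ⟨j, Finset.mem_insert_of_mem hj⟩ (fun h => hjr (congrArg Subtype.val h))
    rw [if_neg hjr, lt_exp_iff_le] at this
    exact this.trans (WithZero.exp_le_exp.mpr (by dsimp only; omega))
  · intro j hj
    have hjr : j.1 ≠ r := fun h => hj (Subtype.ext h)
    obtain ⟨g, hg, hgr, hgj, hgo⟩ := hpair j (hmemS j hjr)
    refine ⟨g, hg, by rw [if_pos rfl]; exact hgr, by rw [if_neg hjr]; exact hgj,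
      fun i hi hij => ?_⟩
    have hir : i.1 ≠ r := fun h => hi (Subtype.ext h)
    rw [if_neg hir, lt_exp_iff_le]
    refine (hgo i (hmemS i hir) fun h => hij (Subtype.ext h)).trans
      (WithZero.exp_le_exp.mpr (by omega))
  · obtain ⟨j, hj⟩ := hSne
    exact ⟨⟨j, Finset.mem_insert_of_mem hj⟩, fun h => hrS (by
      rwa [show j = r from congrArg Subtype.val h] at hj)⟩

/-- Combining a pure element of order `β r` with an element of large orders everywhere gives a point
of the fiber over `{r}`, which maximality makes empty. -/
theorem notMem_pureOrders_of_mem_relMaximals (hw : IsBranchSystem R w) [Finite ι]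
    (hbig : ∀ N : ι → ℤ, ∃ α ∈ orderSet w M, N ≤ α) {J : Finset ι} {r : J} {β : J → ℤ}
    (hβ : β ∈ relMaximals (orderSet (fun j : J => w j) M)) : β r ∉ pureOrders w M r := by
  classical
  rintro ⟨h, hh, hhr, hho⟩
  obtain ⟨α, ⟨g, hg, hα⟩, hle⟩ := hbig fun i => if hi : i ∈ J then β ⟨i, hi⟩ + 1 else 0
  obtain ⟨z, hz, hzw⟩ := hw.exists_mem_map_eq_max hh hg
  have hαβ : ∀ j : J, β j < α j := fun j => by
    have := hle j
    simp only [j.2, dif_pos] at this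
    exact Int.lt_of_add_one_le this
  have hzr : w r z = WithZero.exp (-β r) := by
    rw [hzw, hhr, hα, max_eq_left (WithZero.exp_le_exp.mpr (neg_le_neg (hαβ r).le))]
  have hzo : ∀ j : J, j ≠ r → w j z = WithZero.exp (-α j) := fun j hj => by
    rw [hzw, hho j fun h => hj (Subtype.ext h), hα, max_eq_right zero_le]
  have hmem : Function.update (fun j : J => α j) r (β r) ∈
      fiber {r} (orderSet (fun j : J => w j) M) β := by
    refine ⟨⟨z, hz, fun j => ?_⟩, fun j hj => ?_, fun j hj => ?_⟩
    · by_cases hj : j = r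
      · subst hj; rw [Function.update_self]; exact hzr
      · rw [Function.update_of_ne hj]; exact hzo j hj
    · rw [Finset.mem_singleton] at hj
      subst hj
      rw [Function.update_self]
    · rw [Finset.mem_singleton] at hj
      rw [Function.update_of_ne hj]
      exact hαβ j
  rw [hβ.1.2 r] at hmem
  exact hmem

theorem mem_pureOrders_of_le (hw : IsBranchSystem R w) {c : ι → ℤ}
    (hc : ∀ h, (∀ i, w i h ≤ WithZero.exp (-c i)) → h ∈ M) {r : ι} {x : ℤ} (hx : c r ≤ x) :
    x ∈ pureOrders w M r := by
  obtain ⟨h, hr, ho⟩ := hw.exists_map_eq_exp_and_zero r (-x)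
  refine ⟨h, hc h fun i => ?_, hr, ho⟩
  by_cases hi : i = r
  · subst hi; rw [hr, WithZero.exp_le_exp]; omega
  · rw [ho i hi]; exact zero_le

/-- The component `(1 - e) * h` off branch `r` is beyond the conductor, hence in `M`, so the
component `e * h` on branch `r` is in `M` too. -/
theorem mem_pureOrders_of_forall_le (hw : IsBranchSystem R w) {c : ι → ℤ}
    (hc : ∀ h, (∀ i, w i h ≤ WithZero.exp (-c i)) → h ∈ M) {r : ι} {x : ℤ} {h : K} (hh : h ∈ M)
    (hr : w r h = WithZero.exp (-x)) (ho : ∀ j, j ≠ r → w j h ≤ WithZero.exp (-c j)) :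
    x ∈ pureOrders w M r := by
  obtain ⟨e, he, he'⟩ := hw.proj r
  have hdiff : (1 - e) * h ∈ M := by
    refine hc _ fun i => ?_
    rw [map_mul]
    by_cases hi : i = r
    · subst hi; rw [he, zero_mul]; exact zero_le
    · refine le_trans (mul_le_of_le_one_left' ?_) (ho i hi)
      refine (w i).map_sub_le (map_one _).le ?_
      rw [he' i hi]; exact zero_le
  refine ⟨e * h, ?_, ?_, fun j hj => ?_⟩
  · have := M.sub_mem hh hdiff
    rwa [sub_mul, one_mul, sub_sub_cancel] at this
  · rw [map_mul, map_eq_one_of_map_one_sub_eq_zero _ he, one_mul, hr]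
  · rw [map_mul, he' j hj, zero_mul]

/-- The coordinates of the relative maximals are the orders of elements of `M` that are not orders
of elements vanishing on the other branches. -/
theorem setOf_relMaximals_eq (hw : IsBranchSystem R w) [Fintype ι] {b c : ι → ℤ}
    (hb : ∀ h ∈ M, ∀ i, w i h ≤ WithZero.exp (b i))
    (hbig : ∀ N : ι → ℤ, ∃ α ∈ orderSet w M, N ≤ α)
    (hc : ∀ h, (∀ i, w i h ≤ WithZero.exp (-c i)) → h ∈ M) (r : ι) :
    {x | ∃ (J : Finset ι) (hJ : {r} ⊂ J), ∃ β ∈ relMaximals (orderSet (fun j : J => w j) M),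
      x = β ⟨r, hJ.1 (Finset.mem_singleton_self r)⟩} =
    branchOrders w M r \ pureOrders w M r := by
  ext x
  constructor
  · rintro ⟨J, hJ, β, hβ, rfl⟩
    refine ⟨?_, hw.notMem_pureOrders_of_mem_relMaximals hbig (r := ⟨r, _⟩) hβ⟩
    obtain ⟨h, hh, hα⟩ := hβ.1.1
    exact ⟨h, hh, hα ⟨r, _⟩⟩
  · rintro ⟨hx, hx'⟩
    -- The sum serves only as a common upper bound for all `c j`.
    refine hw.exists_relMaximal hb hbig hx (N₀ := ∑ i, |c i|) fun h hh hr => ?_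
    by_contra! hcon
    refine hx' (hw.mem_pureOrders_of_forall_le hc hh hr fun j hj =>
      (hcon j hj).trans (WithZero.exp_le_exp.mpr (neg_le_neg ?_)))
    exact (le_abs_self _).trans
      (Finset.single_le_sum (f := fun i => |c i|) (fun i _ => abs_nonneg _) (Finset.mem_univ j))

end IsBranchSystem

end LastBranch

end Colength

namespace Colength

open IsLocalRing

/-! ### Lengths as numbers of orders. -/

section Length

theorem length_quotient_submoduleOf_eq_add {R K : Type*} [Ring R] [AddCommGroup K] [Module R K]
    {A B C : Submodule R K} (hAB : A ≤ B) (hBC : B ≤ C) :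
    Module.length R (C ⧸ A.submoduleOf C) =
      Module.length R (B ⧸ A.submoduleOf B) + Module.length R (C ⧸ B.submoduleOf C) := by
  have hr : LinearMap.range (Submodule.inclusion hBC) = B.submoduleOf C :=
    Submodule.range_inclusion _ _ hBC
  have := length_quotient_eq_add (Submodule.inclusion hBC) (p := A.submoduleOf C)
    (by rw [hr]; exact Submodule.comap_mono hAB)
  rw [this, hr]
  rfl

variable {R K : Type*} [CommRing R] [IsLocalRing R] [CommRing K] [Algebra R K] {ι : Type}
  {w : ι → Valuation K ℤᵐ⁰} (hw : IsBranchSystem R w)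

/-- The elements of order at least `x` in the branch `i`. -/
def IsBranchSystem.ball (i : ι) (x : ℤ) : Submodule R K where
  carrier := {h | w i h ≤ WithZero.exp (-x)}
  zero_mem' := by simp
  add_mem' := fun ha hb => (w i).map_add_le ha hb
  smul_mem' := fun a h hh => (hw.map_smul_le i a h).trans hh

namespace IsBranchSystem

theorem mem_ball {i : ι} {x : ℤ} {h : K} : h ∈ hw.ball i x ↔ w i h ≤ WithZero.exp (-x) := Iff.rfl

theorem ball_add_one_le (i : ι) (x : ℤ) : hw.ball i (x + 1) ≤ hw.ball i x := fun _ hh =>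
  (hw.mem_ball.mp hh).trans (WithZero.exp_le_exp.mpr (by omega))

/-- By the residue condition two elements of exact order `x` agree up to a scalar modulo higher
order, so the quotient is simple or zero. Writing 0 or 1 as an `encard` lets the steps add up as
disjoint unions. -/
theorem length_ball_quotient (N : Submodule R K) (i : ι) (x : ℤ) :
    Module.length R (↥(N ⊓ hw.ball i x) ⧸
      (N ⊓ hw.ball i (x + 1)).submoduleOf (N ⊓ hw.ball i x)) =
    {y | y = x ∧ y ∈ branchOrders w N i}.encard := by
  have hmem : ∀ g : ↥(N ⊓ hw.ball i x),
      g ∈ (N ⊓ hw.ball i (x + 1)).submoduleOf (N ⊓ hw.ball i x) ↔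
        w i (g : K) < WithZero.exp (-x) := by
    intro g
    rw [lt_exp_iff_le, ← neg_add']
    exact ⟨fun h => h.2, fun h => ⟨g.2.1, h⟩⟩
  by_cases hx : x ∈ branchOrders w N i
  · have hset : {y | y = x ∧ y ∈ branchOrders w N i} = {x} := by
      ext y
      exact ⟨fun h => h.1, fun h => ⟨h, by rw [Set.mem_singleton_iff.mp h]; exact hx⟩⟩
    rw [hset, Set.encard_singleton, Module.length_eq_one_iff,
      isSimpleModule_iff_toSpanSingleton_surjective]
    obtain ⟨h, hh, hhx⟩ := hx
    constructor
    · refine ⟨⟨Submodule.Quotient.mk ⟨h, hh, hhx.le⟩, 0, ?_⟩⟩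
      rw [Ne, Submodule.Quotient.mk_eq_zero, hmem]
      exact hhx.not_lt
    · intro m hm q
      obtain ⟨m, rfl⟩ := Submodule.Quotient.mk_surjective _ m
      obtain ⟨q, rfl⟩ := Submodule.Quotient.mk_surjective _ q
      rw [Ne, Submodule.Quotient.mk_eq_zero, hmem, not_lt] at hm
      have hm' : w i (m : K) = WithZero.exp (-x) := le_antisymm m.2.2 hm
      rcases (show w i (q : K) ≤ WithZero.exp (-x) from q.2.2).lt_or_eq with hq | hq
      · refine ⟨0, ?_⟩
        rw [map_zero, eq_comm, Submodule.Quotient.mk_eq_zero, hmem]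
        exact hq
      · obtain ⟨a, ha⟩ := hw.residue i q m (hq.trans hm'.symm)
          (by rw [hm']; exact WithZero.exp_ne_zero)
        refine ⟨a, ?_⟩
        rw [LinearMap.toSpanSingleton_apply, ← Submodule.Quotient.mk_smul, eq_comm,
          Submodule.Quotient.eq, hmem]
        exact ha.trans_eq hm'
  · have hset : {y | y = x ∧ y ∈ branchOrders w N i} = ∅ := by
      rw [Set.eq_empty_iff_forall_notMem]
      rintro y ⟨rfl, hy⟩
      exact hx hy
    rw [hset, Set.encard_empty, Module.length_eq_zero_iff, Submodule.Quotient.subsingleton_iff,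
      eq_top_iff]
    intro g _
    rw [hmem]
    exact lt_of_le_of_ne g.2.2 fun h => hx ⟨g, g.2.1, h⟩

theorem length_quotient_ball {N : Submodule R K} {i : ι} {b : ℤ}
    (hb : ∀ h ∈ N, w i h ≤ WithZero.exp b) (x : ℤ) :
    Module.length R (N ⧸ (N ⊓ hw.ball i x).submoduleOf N) =
      (branchOrders w N i ∩ Set.Iio x).encard := by
  have hlow : ∀ y ∈ branchOrders w N i, -b ≤ y := by
    rintro y ⟨h, hh, hy⟩
    have := hb h hh
    rw [hy, WithZero.exp_le_exp] at this
    omega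
  -- The induction starts at a level `m` below all orders, where the ball contains `N`.
  obtain ⟨m, hm, hmx⟩ : ∃ m, m ≤ -b ∧ m ≤ x := ⟨min (-b) x, min_le_left _ _, min_le_right _ _⟩
  induction x, hmx using Int.leInduction with
  | base =>
    have h1 : N ⊓ hw.ball i m = N := inf_eq_left.mpr fun h hh =>
      (hb h hh).trans (WithZero.exp_le_exp.mpr (by omega))
    have h2 : branchOrders w N i ∩ Set.Iio m = ∅ := by
      rw [Set.eq_empty_iff_forall_notMem]
      rintro y ⟨hy, hym⟩
      have := hlow y hy
      rw [Set.mem_Iio] at hym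
      omega
    rw [h1, h2, Set.encard_empty, Module.length_eq_zero_iff,
      Submodule.Quotient.subsingleton_iff, Submodule.submoduleOf_self]
  | succ x hx ih =>
    rw [length_quotient_submoduleOf_eq_add (inf_le_inf_left N (hw.ball_add_one_le i x))
      inf_le_left, ih, hw.length_ball_quotient, ← Set.encard_union_eq]
    · congr 1
      ext y
      simp only [Set.mem_union, Set.mem_ofPred_eq, Set.mem_inter_iff, Set.mem_Iio]
      constructor
      · rintro (⟨rfl, hy⟩ | ⟨hy, hlt⟩)
        · exact ⟨hy, by omega⟩
        · exact ⟨hy, by omega⟩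
      · rintro ⟨hy, hlt⟩
        rcases (by omega : y = x ∨ y < x) with h | h
        · exact Or.inl ⟨h, hy⟩
        · exact Or.inr ⟨hy, h⟩
    · rw [Set.disjoint_left]
      rintro y ⟨rfl, -⟩ ⟨-, hlt⟩
      exact lt_irrefl y hlt

theorem length_quotient_iInf_ball_ne_top {M : Submodule R K} {b : ι → ℤ}
    (hb : ∀ h ∈ M, ∀ i, w i h ≤ WithZero.exp (b i)) (γ : ι → ℤ) (S : Finset ι) :
    Module.length R (M ⧸ (M ⊓ ⨅ j ∈ S, hw.ball j (γ j)).submoduleOf M) ≠ ⊤ := by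
  classical
  induction S using Finset.induction_on with
  | empty =>
    have : M ⊓ ⨅ j ∈ (∅ : Finset ι), hw.ball j (γ j) = M := by simp
    rw [this, Submodule.submoduleOf_self, Module.length_eq_zero]
    exact ENat.zero_ne_top
  | insert i S hi ih =>
    have heq : M ⊓ ⨅ j ∈ insert i S, hw.ball j (γ j) =
        (M ⊓ ⨅ j ∈ S, hw.ball j (γ j)) ⊓ hw.ball i (γ i) := by
      rw [Finset.iInf_insert, inf_comm (hw.ball i (γ i)), inf_assoc]
    rw [heq, length_quotient_submoduleOf_eq_add inf_le_left inf_le_left, Ne, ENat.add_eq_top,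
      not_or]
    refine ⟨?_, ih⟩
    rw [hw.length_quotient_ball (b := b i) (fun h hh => hb h (Submodule.mem_inf.mp hh).1 i),
      Set.encard_eq_top_iff, Set.not_infinite]
    refine (Set.finite_Ico (-b i) (γ i)).subset ?_
    rintro y ⟨⟨h, hh, hy⟩, hlt⟩
    have := hb h hh.1 i
    rw [hy, WithZero.exp_le_exp] at this
    exact ⟨by omega, hlt⟩

end IsBranchSystem

end Length

/-! ### Counting the integers between the minimum and `γ r`. -/

section Counting

/-- The interval `[a, g)` is the disjoint union of the gaps of `S`, of `S \ X`, and of the part of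
`X` below `g`. -/
theorem ncard_inter_Iio_eq {S X : Set ℤ} {a c g : ℤ} (ha : IsLeast S a) (hXS : X ⊆ S)
    (hc : ∀ x, c ≤ x → x ∈ X) (hcg : c ≤ g) :
    (gaps S).Finite ∧ (S \ X).Finite ∧
      ((X ∩ Set.Iio g).ncard : ℤ) = g - a - (gaps S).ncard - (S \ X).ncard := by
  have hgap : ∀ x ∈ gaps S, a ≤ x ∧ x < g := by
    rintro x ⟨⟨y, hy, hyx⟩, hx⟩
    refine ⟨(ha.2 hy).trans hyx.le, ?_⟩
    by_contra! h
    exact hx (hXS (hc x (hcg.trans h)))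
  have hdiff : ∀ x ∈ S \ X, a ≤ x ∧ x < g := by
    rintro x ⟨hx, hx'⟩
    refine ⟨ha.2 hx, ?_⟩
    by_contra! h
    exact hx' (hc x (hcg.trans h))
  have hfin := Set.finite_Ico a g
  have h1 : (gaps S).Finite := hfin.subset hgap
  have h2 : (S \ X).Finite := hfin.subset hdiff
  have h3 : (X ∩ Set.Iio g).Finite := hfin.subset fun x hx => ⟨ha.2 (hXS hx.1), hx.2⟩
  refine ⟨h1, h2, ?_⟩
  have hunion : (gaps S ∪ S \ X) ∪ X ∩ Set.Iio g = Set.Ico a g := by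
    ext x
    constructor
    · rintro ((h | h) | h)
      · exact hgap x h
      · exact hdiff x h
      · exact ⟨ha.2 (hXS h.1), h.2⟩
    · rintro ⟨hax, hxg⟩
      by_cases hxX : x ∈ X
      · exact Or.inr ⟨hxX, hxg⟩
      by_cases hxS : x ∈ S
      · exact Or.inl (Or.inr ⟨hxS, hxX⟩)
      · exact Or.inl (Or.inl ⟨⟨a, ha.1, lt_of_le_of_ne hax fun h => hxS (h ▸ ha.1)⟩, hxS⟩)
  have hd1 : Disjoint (gaps S) (S \ X) := Set.disjoint_left.mpr fun x h h' => h.2 h'.1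
  have hd2 : Disjoint (gaps S ∪ S \ X) (X ∩ Set.Iio g) := by
    rw [Set.disjoint_left]
    rintro x (h | h) h'
    · exact h.2 (hXS h'.1)
    · exact h.2 h'.1
  have hcard := congrArg Set.ncard hunion
  rw [Set.ncard_union_eq hd2 (h1.union h2) h3, Set.ncard_union_eq hd1 h1 h2] at hcard
  have hI : ((Set.Ico a g).ncard : ℤ) = g - a := by
    rw [← Finset.coe_Ico, Set.ncard_coe_finset, Int.card_Ico, Int.toNat_of_nonneg]
    have := ha.2 (hXS (hc c le_rfl))
    omega
  rw [← hcard] at hI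
  push_cast at hI
  omega

end Counting

/-! ### Translation to fractional ideals. -/

section FractionalIdeals

universe u

variable {R : Type u} [CommRing R] {r : ℕ} (P : Fin r ≃ minimalPrimes R)
  (M : FractionalIdeal R⁰ (FractionRing R))

/-- Regular elements are those nonzero on every branch, so the default value of `WithZero.log` at 0
never enters. -/
theorem idealValueSet_eq [IsReduced R] :
    idealValueSet P M = orderSet (val P) (M : Submodule R (FractionRing R)) := by
  ext α
  constructor
  · rintro ⟨h, hh, hreg, hα⟩
    rw [mem_nonZeroDivisors_fractionRing_iff P] at hreg
    exact ⟨h, hh, fun i => by rw [hα, neg_neg, WithZero.exp_log (hreg i)]⟩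
  · rintro ⟨h, hh, hα⟩
    refine ⟨h, hh, ?_, fun i => by rw [hα, WithZero.log_exp, neg_neg]⟩
    rw [mem_nonZeroDivisors_fractionRing_iff P]
    exact fun i => by rw [hα]; exact WithZero.exp_ne_zero

theorem projValueSet_eq (J : Finset (Fin r)) : projValueSet P M J =
    orderSet (fun j : J => val P j) (M : Submodule R (FractionRing R)) := by
  ext α
  constructor
  · rintro ⟨_, ⟨h, hh, rfl⟩, hreg, hα⟩
    rw [projPartial_mem_nonZeroDivisors_iff] at hreg
    refine ⟨h, hh, fun i => ?_⟩
    rw [hα, neg_neg, partialVal_projPartial, WithZero.exp_log (hreg i i.2)]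
  · rintro ⟨h, hh, hα⟩
    refine ⟨projPartial P J h, ⟨h, hh, rfl⟩, ?_, fun i => ?_⟩
    · rw [projPartial_mem_nonZeroDivisors_iff]
      exact fun j hj => by rw [hα ⟨j, hj⟩]; exact WithZero.exp_ne_zero
    · rw [partialVal_projPartial, hα, WithZero.log_exp, neg_neg]

theorem branchValueSet_eq (i : Fin r) : branchValueSet P M i =
    branchOrders (val P) (M : Submodule R (FractionRing R)) i := by
  ext x
  rw [branchValueSet, projValueSet_eq]
  constructor
  · rintro ⟨β, ⟨h, hh, hβ⟩, rfl⟩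
    exact ⟨h, hh, hβ ⟨i, Finset.mem_singleton_self i⟩⟩
  · rintro ⟨h, hh, hx⟩
    refine ⟨fun _ => x, ⟨h, hh, fun j => ?_⟩, rfl⟩
    have hj : j.1 = i := Finset.mem_singleton.mp j.2
    dsimp only
    rw [hj, hx]

variable [IsLocalRing R]

theorem colength_eq (hw : IsBranchSystem R (val P)) (γ : Fin r → ℤ) :
    colength P M γ = Module.length R ((M : Submodule R (FractionRing R)) ⧸
      ((M : Submodule R (FractionRing R)) ⊓
        ⨅ j ∈ Finset.univ, hw.ball j (γ j)).submoduleOf (M : Submodule R (FractionRing R))) := by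
  have : truncation (val P) (val_algebraMap_le_one P) (M : Submodule R (FractionRing R)) γ =
      (M : Submodule R (FractionRing R)) ⊓ ⨅ j ∈ Finset.univ, hw.ball j (γ j) := by
    ext h
    simp only [Submodule.mem_inf, Submodule.mem_iInf, Finset.mem_univ, forall_const]
    rfl
  rw [colength, this]

/-- Orders on `K_J` pull back to orders on `K`, so the projected colength is computed inside `M` by
imposing only the bounds at `J`. -/
theorem projColength_eq (hw : IsBranchSystem R (val P)) (J : Finset (Fin r)) (γ : Fin r → ℤ) :
    projColength P M J (fun j => γ j) = Module.length R ((M : Submodule R (FractionRing R)) ⧸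
      ((M : Submodule R (FractionRing R)) ⊓
        ⨅ j ∈ J, hw.ball j (γ j)).submoduleOf (M : Submodule R (FractionRing R))) := by
  rw [projColength]
  set T := (truncation (partialVal P J) (partialVal_algebraMap_le_one P J)
      (projIdeal P M J) (fun j => γ j)).submoduleOf (projIdeal P M J) with hT
  let f : (M : Submodule R (FractionRing R)) →ₗ[R] (projIdeal P M J ⧸ T) :=
    T.mkQ ∘ₗ (projPartial P J).submoduleMap (M : Submodule R (FractionRing R))
  have hf : Function.Surjective f :=
    (Submodule.mkQ_surjective T).comp (LinearMap.submoduleMap_surjective _ _)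
  have hker : LinearMap.ker f = ((M : Submodule R (FractionRing R)) ⊓
        ⨅ j ∈ J, hw.ball j (γ j)).submoduleOf (M : Submodule R (FractionRing R)) := by
    ext h
    refine (Submodule.Quotient.mk_eq_zero T).trans ?_
    simp only [Submodule.submoduleOf, Submodule.mem_comap, Submodule.subtype_apply,
      Submodule.mem_inf, Submodule.mem_iInf, hT]
    constructor
    · rintro ⟨-, hle⟩
      refine ⟨h.2, fun j hj => ?_⟩
      exact (partialVal_projPartial P J ⟨j, hj⟩ h).ge.trans (hle ⟨j, hj⟩)
    · rintro ⟨-, hle⟩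
      refine ⟨((projPartial P J).submoduleMap (M : Submodule R (FractionRing R)) h).2,
        fun j => ?_⟩
      exact (partialVal_projPartial P J j h).le.trans (hle j j.2)
  rw [← hker]
  exact (f.quotKerEquivOfSurjective hf).length_eq.symm

end FractionalIdeals

end Colength

namespace Colength

section FractionalIdeals

universe u

variable {R : Type u} [CommRing R] [IsLocalRing R] {r : ℕ} (P : Fin r ≃ minimalPrimes R)
  (M : FractionalIdeal R⁰ (FractionRing R))

theorem IsCompleteAdmissible.val_algebraMap_ne_zero (hR : IsCompleteAdmissible R) {d : R}
    (hd : d ∈ R⁰) (i : Fin r) :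
    val P i (algebraMap R (FractionRing R) d) ≠ 0 := by
  have := hR.isReduced
  exact (mem_nonZeroDivisors_fractionRing_iff P _).mp
    (IsLocalization.map_units (FractionRing R) (⟨d, hd⟩ : R⁰)).mem_nonZeroDivisors i

theorem IsCompleteAdmissible.exists_val_le (hR : IsCompleteAdmissible R) :
    ∃ b : Fin r → ℤ, ∀ h ∈ (M : Submodule R (FractionRing R)), ∀ i,
      val P i h ≤ WithZero.exp (b i) := by
  obtain ⟨d, hd, hdM⟩ := M.isFractional
  refine ⟨fun i => -WithZero.log (val P i (algebraMap R (FractionRing R) d)), fun h hh i => ?_⟩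
  obtain ⟨a, ha⟩ := hdM h hh
  have hd0 := hR.val_algebraMap_ne_zero P hd i
  have hle := val_algebraMap_le_one P i a
  rw [ha, Algebra.smul_def, map_mul] at hle
  rw [WithZero.exp_neg, WithZero.exp_log hd0]
  rwa [← mul_one (val P i (algebraMap R (FractionRing R) d))⁻¹,
    le_inv_mul_iff₀ (zero_lt_iff.mpr hd0)]

theorem IsCompleteAdmissible.exists_forall_mem (hR : IsCompleteAdmissible R)
    (hM : ∃ d ∈ R⁰, algebraMap R (FractionRing R) d ∈ M) :
    ∃ c : Fin r → ℤ, ∀ h, (∀ i, val P i h ≤ WithZero.exp (-c i)) →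
      h ∈ (M : Submodule R (FractionRing R)) := by
  obtain ⟨d, hd, hdM⟩ := hM
  obtain ⟨c, hc⟩ := hR.exists_conductor P
  -- The conductor of `R` is shifted by the order of the regular element `d`, so that `h / d` lies
  -- in `R`.
  refine ⟨fun i => c i - WithZero.log (val P i (algebraMap R (FractionRing R) d)), fun h hh => ?_⟩
  obtain ⟨e, he⟩ := (IsLocalization.map_units (FractionRing R) (⟨d, hd⟩ : R⁰)).exists_right_inv
  obtain ⟨a, ha⟩ := hc (h * e) fun i => by
    have hd0 := hR.val_algebraMap_ne_zero P hd i
    have h1 := congrArg (val P i) he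
    rw [map_mul, map_one] at h1
    have h2 := hh i
    rw [neg_sub, sub_eq_add_neg, WithZero.exp_add, WithZero.exp_log hd0] at h2
    rw [map_mul]
    calc val P i h * val P i e
        ≤ val P i (algebraMap R (FractionRing R) d) * WithZero.exp (-c i) * val P i e := by gcongr
      _ = val P i (algebraMap R (FractionRing R) d) * val P i e * WithZero.exp (-c i) :=
          mul_right_comm _ _ _
      _ = WithZero.exp (-c i) := by rw [h1, one_mul]
  have hha : h = a • algebraMap R (FractionRing R) d := by
    rw [Algebra.smul_def, ha, mul_assoc, mul_comm e, he, mul_one]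
  rw [hha]
  exact Submodule.smul_mem _ a hdM

end FractionalIdeals

theorem neg_le_of_mem_orderSet {R K : Type*} [CommRing R] [CommRing K] [Algebra R K] {ι : Type}
    {w : ι → Valuation K ℤᵐ⁰} {M : Submodule R K} {b : ι → ℤ}
    (hb : ∀ h ∈ M, ∀ i, w i h ≤ WithZero.exp (b i)) {α : ι → ℤ} (hα : α ∈ orderSet w M) :
    -b ≤ α := by
  obtain ⟨h, hh, hα⟩ := hα
  intro i
  have := hb h hh i
  rw [hα, WithZero.exp_le_exp] at this
  exact neg_le.mp this

section BranchSystem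

variable {R K : Type*} [CommRing R] [IsLocalRing R] [CommRing K] [Algebra R K] {ι : Type}
  [Fintype ι] {w : ι → Valuation K ℤᵐ⁰} {M : Submodule R K} {b c' : ι → ℤ}

namespace IsBranchSystem

theorem mem_orderSet_of_le (hw : IsBranchSystem R w)
    (hc' : ∀ h, (∀ i, w i h ≤ WithZero.exp (-c' i)) → h ∈ M)
    {α : ι → ℤ} (hα : c' ≤ α) : α ∈ orderSet w M := by
  obtain ⟨x, hx⟩ := hw.exists_map_eq_exp (-α)
  exact ⟨x, hc' x fun i => by
    rw [hx, WithZero.exp_le_exp]; exact neg_le_neg (hα i), hx⟩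

theorem exists_mem_orderSet_ge (hw : IsBranchSystem R w)
    (hc' : ∀ h, (∀ i, w i h ≤ WithZero.exp (-c' i)) → h ∈ M)
    (N : ι → ℤ) : ∃ α ∈ orderSet w M, N ≤ α :=
  ⟨c' ⊔ N, hw.mem_orderSet_of_le hc' le_sup_left, le_sup_right⟩

/-- Combining with an element of large orders makes the remaining orders finite and keeps the order
`x` on branch `i`. Hence `α⁰ r` is also the minimum of `E_r`. -/
theorem le_of_mem_branchOrders (hw : IsBranchSystem R w)
    (hc' : ∀ h, (∀ i, w i h ≤ WithZero.exp (-c' i)) → h ∈ M)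
    {α : ι → ℤ} (hα : IsLeast (orderSet w M) α) {i : ι} {x : ℤ}
    (hx : x ∈ branchOrders w M i) : α i ≤ x := by
  obtain ⟨h, hh, hhx⟩ := hx
  obtain ⟨β, ⟨g, hg, hβ⟩, hle⟩ := hw.exists_mem_orderSet_ge hc' fun _ => x
  obtain ⟨z, hz, hzw⟩ := hw.exists_mem_map_eq_max hh hg
  have hne : ∀ j, w j z ≠ 0 := fun j h0 => by
    rw [hzw, hβ] at h0
    exact absurd (h0 ▸ le_max_right (w j h) (WithZero.exp (-β j))) (not_le.mpr WithZero.exp_pos)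
  have := hα.2 (show (fun j => -WithZero.log (w j z)) ∈ orderSet w M from
    ⟨z, hz, fun j => by rw [neg_neg, WithZero.exp_log (hne j)]⟩) i
  dsimp only at this
  rwa [hzw, hhx, hβ, max_eq_left (WithZero.exp_le_exp.mpr (neg_le_neg (hle i))),
    WithZero.log_exp, neg_neg] at this

theorem exists_isLeast_orderSet (hw : IsBranchSystem R w)
    (hb : ∀ h ∈ M, ∀ i, w i h ≤ WithZero.exp (b i))
    (hc' : ∀ h, (∀ i, w i h ≤ WithZero.exp (-c' i)) → h ∈ M) : ∃ α, IsLeast (orderSet w M) α :=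
  exists_isLeast_of_inf_mem ⟨c', hw.mem_orderSet_of_le hc' le_rfl⟩
    (fun _ hα _ hβ => hw.inf_mem_orderSet hα hβ)
    (fun _ hα => neg_le_of_mem_orderSet hb hα)

theorem exists_isConductor_orderSet (hw : IsBranchSystem R w)
    (hb : ∀ h ∈ M, ∀ i, w i h ≤ WithZero.exp (b i))
    (hc' : ∀ h, (∀ i, w i h ≤ WithZero.exp (-c' i)) → h ∈ M) :
    ∃ c, IsConductor (orderSet w M) c := by
  refine exists_isLeast_of_inf_mem
    ⟨c', hw.mem_orderSet_of_le hc' le_rfl, fun β hβ => hw.mem_orderSet_of_le hc' hβ⟩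
    (fun α hα β hβ => ⟨hw.inf_mem_orderSet hα.1 hβ.1, fun δ hδ => ?_⟩)
    (fun _ hα => neg_le_of_mem_orderSet hb hα.1)
  -- Distributivity shows that the set of candidate conductors is closed under infima.
  have : (δ ⊔ α) ⊓ (δ ⊔ β) = δ := by rw [← sup_inf_left, sup_eq_left.mpr hδ]
  rw [← this]
  exact hw.inf_mem_orderSet (hα.2 _ le_sup_right) (hβ.2 _ le_sup_right)

end IsBranchSystem

end BranchSystem

end Colength

open Colength in
theorem theorem10 {R : Type*} [CommRing R] [IsLocalRing R] (hR : IsCompleteAdmissible R)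
    {n : ℕ} (P : Fin (n + 1) ≃ minimalPrimes R)
    (M : FractionalIdeal (nonZeroDivisors R) (FractionRing R))
    (hM : ∃ d ∈ nonZeroDivisors R, algebraMap R (FractionRing R) d ∈ M) :
    ∃ α₀ c : Fin (n + 1) → ℤ,
      IsLeast (idealValueSet P M) α₀ ∧ IsConductor (idealValueSet P M) c ∧
      ∀ γ : Fin (n + 1) → ℤ, c ≤ γ →
        colength P M γ ≠ ⊤ ∧
        projColength P M {Fin.last n}ᶜ (fun j => γ j) ≠ ⊤ ∧
        (gaps (branchValueSet P M (Fin.last n))).Finite ∧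
        (relMaximalCoords (projValueSet P M) (Fin.last n)).Finite ∧
        ((colength P M γ).toNat : ℤ) =
          ((projColength P M {Fin.last n}ᶜ (fun j => γ j)).toNat : ℤ)
            + (γ (Fin.last n) - α₀ (Fin.last n))
            - ((gaps (branchValueSet P M (Fin.last n))).ncard : ℤ)
            - ((relMaximalCoords (projValueSet P M) (Fin.last n)).ncard : ℤ) := by
  have := hR.isReduced
  have hw := hR.isBranchSystem P
  obtain ⟨b, hb⟩ := hR.exists_val_le P M
  obtain ⟨c', hc'⟩ := hR.exists_forall_mem P M hM
  have hbig := hw.exists_mem_orderSet_ge hc'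
  obtain ⟨α₀, hα₀⟩ := hw.exists_isLeast_orderSet hb hc'
  obtain ⟨c, hc⟩ := hw.exists_isConductor_orderSet hb hc'
  have hcM : ∀ h, (∀ i, val P i h ≤ WithZero.exp (-c i)) →
      h ∈ (M : Submodule R (FractionRing R)) :=
    fun h hh => hw.mem_of_le_conductor hc' hc.1.2 hh
  refine ⟨α₀, c, by rwa [idealValueSet_eq], by rwa [idealValueSet_eq], fun γ hγ => ?_⟩
  set l := Fin.last n
  set M' : Submodule R (FractionRing R) := (M : Submodule R (FractionRing R)) with hM'
  have hrel : relMaximalCoords (projValueSet P M) l =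
      branchOrders (val P) M' l \ pureOrders (val P) M' l := by
    rw [← hw.setOf_relMaximals_eq hb hbig hcM l, relMaximalCoords]
    simp only [projValueSet_eq]
    rfl
  have hleast : IsLeast (branchOrders (val P) M' l) (α₀ l) := by
    refine ⟨?_, fun x hx => hw.le_of_mem_branchOrders hc' hα₀ hx⟩
    obtain ⟨h, hh, hα⟩ := hα₀.1
    exact ⟨h, hh, hα l⟩
  obtain ⟨hgaps, hdiff, hcount⟩ := ncard_inter_Iio_eq hleast
    (pureOrders_subset_branchOrders M' l) (fun x hx => hw.mem_pureOrders_of_le hcM hx) (hγ l)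
  set N : Submodule R (FractionRing R) := M' ⊓ ⨅ j ∈ ({l}ᶜ : Finset (Fin (n + 1))),
    hw.ball j (γ j) with hN
  have hmemN : ∀ h, h ∈ N ↔ h ∈ M' ∧ ∀ j, j ≠ l → val P j h ≤ WithZero.exp (-γ j) := by
    intro h
    simp only [hN, Submodule.mem_inf, Submodule.mem_iInf, Finset.mem_compl, Finset.mem_singleton]
    rfl
  have huniv : M' ⊓ ⨅ j ∈ Finset.univ, hw.ball j (γ j) = N ⊓ hw.ball l (γ l) := by
    have : (Finset.univ : Finset (Fin (n + 1))) = insert l {l}ᶜ := by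
      rw [Finset.insert_compl_self]
    rw [this, Finset.iInf_insert, hN, inf_comm (hw.ball l (γ l)), inf_assoc]
  -- This is where `γ ≥ c` matters: elements of `N` are beyond the conductor off branch `l`, so
  -- their orders on `l` are pure.
  have horders : branchOrders (val P) N l ∩ Set.Iio (γ l) =
      pureOrders (val P) M' l ∩ Set.Iio (γ l) := by
    ext x
    refine and_congr_left fun _ => ⟨?_, ?_⟩
    · rintro ⟨h, hh, hx⟩
      obtain ⟨hh, ho⟩ := (hmemN h).mp hh
      exact hw.mem_pureOrders_of_forall_le hcM hh hx fun j hj =>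
        (ho j hj).trans (WithZero.exp_le_exp.mpr (neg_le_neg (hγ j)))
    · rintro ⟨h, hh, hx, ho⟩
      exact ⟨h, (hmemN h).mpr ⟨hh, fun j hj => by rw [ho j hj]; exact zero_le⟩, hx⟩
  have hlen : colength P M γ = (pureOrders (val P) M' l ∩ Set.Iio (γ l)).encard +
      projColength P M {l}ᶜ (fun j => γ j) := by
    rw [colength_eq P M hw, projColength_eq P M hw, huniv,
      length_quotient_submoduleOf_eq_add (inf_le_left : N ⊓ hw.ball l (γ l) ≤ N) inf_le_left,
      hw.length_quotient_ball (b := b l) (fun h hh => hb h ((hmemN h).mp hh).1 l), horders]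
  have hfin : (pureOrders (val P) M' l ∩ Set.Iio (γ l)).Finite :=
    (Set.finite_Ico (α₀ l) (γ l)).subset fun x hx =>
      ⟨hleast.2 (pureOrders_subset_branchOrders M' l hx.1), hx.2⟩
  have hcol : colength P M γ ≠ ⊤ := by
    rw [colength_eq P M hw]
    exact hw.length_quotient_iInf_ball_ne_top hb γ _
  have hproj : projColength P M {l}ᶜ (fun j => γ j) ≠ ⊤ := by
    rw [projColength_eq P M hw]
    exact hw.length_quotient_iInf_ball_ne_top hb γ _
  rw [branchValueSet_eq, hrel]
  refine ⟨hcol, hproj, hgaps, hdiff, ?_⟩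
  rw [hlen, ENat.toNat_add (Set.encard_ne_top_iff.mpr hfin) hproj]
  push_cast
  rw [← Set.ncard_def, hcount]
  ring
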